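/- Theorem 1.2 (Existence I). Let $s\in(0,1)$, let $N\in\mathbb N$ with $N>2s$, let $\Omega\subset\mathbb R^N$ be a bounded domain (a nonempty bounded connected open set), and let $0<\mu<N$ and $2^*_\mu=\frac{2N-\mu}{N-2s}$. Put $$H^s(\mathbb R^N)=\Big\{u\in L^2(\mathbb R^N):\ \iint_{\mathbb R^{2N}}\frac{|u(x)-u(y)|^2}{|x-y|^{N+2s}}\,dx\,dy<\infty\Big\},$$ $$X(\Omega)=\{u\in H^s(\mathbb R^N): u=0\text{ a.e. in }\mathbb R^N\setminus\Omega\},\qquad \langle u,\varphi\rangle_X=\iint_{\mathbb R^{2N}}\frac{(u(x)-u(y))(\varphi(x)-\varphi(y))}{|x-y|^{N+2s}}\,dx\,dy,$$ $$\lambda_{1,s}=\inf_{u\in X(\Omega)\setminus\{0\}}\frac{\langle u,u\rangle_X}{\int_{\mathbb R^N}|u|^2\,dx}.$$ Let $1<p<2^*_\mu$ and $1<q<2^*_\mu$, let $a,b,c\in\mathbb R$ with $b\ge 0$, and let $\mu_2$ be the largest eigenvalue of $A=\begin{pmatrix}a&b\\ b&c\end{pmatrix}$. If $\mu_2<\lambda_{1,s}$,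 then the fractional Choquard system $$\begin{cases}(-\Delta)^s u=au+bv+\dfrac{2p}{p+q}\displaystyle\int_\Omega\frac{|v(y)|^q}{|x-y|^\mu}\,dy\,|u|^{p-2}u&\text{in }\Omega,\\[2mm] (-\Delta)^s v=bu+cv+\dfrac{2q}{p+q}\displaystyle\int_\Omega\frac{|u(y)|^p}{|x-y|^\mu}\,dy\,|v|^{q-2}v&\text{in }\Omega,\\[2mm] u=v=0&\text{in }\mathbb R^N\setminus\Omega\end{cases}$$ has a positive weak solution; that is, there are $u,v\in X(\Omega)$ with $u>0$ and $v>0$ a.e. in $\Omega$ such that, for all $\varphi,\psi\in X(\Omega)$, $$\langle u,\varphi\rangle_X+\langle v,\psi\rangle_X-\int_\Omega\big[(au+bv)\varphi+(bu+cv)\psi\big]dx-\frac{2p}{p+q}\int_\Omega\Big(\int_\Omega\frac{|v(y)|^q}{|x-y|^\mu}dy\Big)|u|^{p-2}u\,\varphi\,dx-\frac{2q}{p+q}\int_\Omega\Big(\int_\Omega\frac{|u(y)|^p}{|x-y|^\mu}dy\Big)|v|^{q-2}v\,\psi\,dx=0.$$ -/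

import Mathlib

open MeasureTheory

noncomputable section

namespace FracChoquard

variable {N : ℕ}

/-- The fractional Sobolev space `H^s(ℝ^N)`: `u` is in `L²` and its Gagliardo seminorm is finite.
Functions are represented by everywhere defined functions, identified almost everywhere. -/
def MemHs (s : ℝ) (u : EuclideanSpace ℝ (Fin N) → ℝ) : Prop :=
  MemLp u 2 volume ∧
    Integrable (fun z : EuclideanSpace ℝ (Fin N) × EuclideanSpace ℝ (Fin N) =>
      (u z.1 - u z.2) ^ 2 / ‖z.1 - z.2‖ ^ ((N : ℝ) + 2 * s)) volume

/-- The space `X(Ω)` of the functions in `H^s(ℝ^N)` that vanish a.e. outside `Ω`. -/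
def MemX (s : ℝ) (Ω : Set (EuclideanSpace ℝ (Fin N))) (u : EuclideanSpace ℝ (Fin N) → ℝ) : Prop :=
  MemHs s u ∧ ∀ᵐ x ∂volume, x ∉ Ω → u x = 0

/-- The inner product of `X(Ω)`,
`∫∫ (u(x) - u(y)) (v(x) - v(y)) / |x - y|^(N + 2s) dx dy` over `ℝ^N × ℝ^N`. -/
def innerX (s : ℝ) (u v : EuclideanSpace ℝ (Fin N) → ℝ) : ℝ :=
  ∫ z : EuclideanSpace ℝ (Fin N) × EuclideanSpace ℝ (Fin N),
    ((u z.1 - u z.2) * (v z.1 - v z.2)) / ‖z.1 - z.2‖ ^ ((N : ℝ) + 2 * s)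

/-- The first eigenvalue `λ_{1,s}` of the fractional Laplacian on `Ω` with zero exterior condition:
the infimum of the Rayleigh quotient `[u]_s² / ‖u‖²_{L²}` over the nonzero `u` in `X(Ω)`. -/
def firstEigenvalue (s : ℝ) (Ω : Set (EuclideanSpace ℝ (Fin N))) : ℝ :=
  sInf {r : ℝ | ∃ u : EuclideanSpace ℝ (Fin N) → ℝ,
    MemX s Ω u ∧ ¬ (u =ᵐ[volume] 0) ∧ r = innerX s u u / ∫ x, (u x) ^ 2}

/-- The upper critical exponent `2*_μ = (2N - μ) / (N - 2s)` for the Hardy-Littlewood-Sobolev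
inequality. -/
def critExp (N : ℕ) (s μ : ℝ) : ℝ :=
  (2 * (N : ℝ) - μ) / ((N : ℝ) - 2 * s)

/-- The potential `x ↦ ∫_Ω |w(y)|^r / |x - y|^μ dy`. -/
def potential (Ω : Set (EuclideanSpace ℝ (Fin N))) (μ r : ℝ) (w : EuclideanSpace ℝ (Fin N) → ℝ)
    (x : EuclideanSpace ℝ (Fin N)) : ℝ :=
  ∫ y in Ω, |w y| ^ r / ‖x - y‖ ^ μ

/-- The nonlinear part of the equation for `u`,
`2p/(p+q) (∫_Ω |v(y)|^q/|x-y|^μ dy) |u|^(p-2) u + 2ξ (∫_Ω |u(y)|^m/|x-y|^μ dy) |u|^(m-2) u`,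
with `m = 2*_μ`. The one of the equation for `v` is obtained by exchanging `u` with `v` and
`p` with `q`. -/
def nonlinearity (s : ℝ) (Ω : Set (EuclideanSpace ℝ (Fin N))) (μ p q ξ : ℝ)
    (u v : EuclideanSpace ℝ (Fin N) → ℝ) (x : EuclideanSpace ℝ (Fin N)) : ℝ :=
  2 * p / (p + q) * potential Ω μ q v x * (|u x| ^ (p - 2) * u x) +
    2 * ξ * potential Ω μ (critExp N s μ) u x * (|u x| ^ (critExp N s μ - 2) * u x)

/-- `(u, v)` is a weak solution of the system
`(-Δ)^s u = a u + b v + nonlinearity p q ξ₁ u v`, `(-Δ)^s v = b u + c v + nonlinearity q p ξ₂ v u`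
in `Ω`, `u = v = 0` outside `Ω`. For `0 < s < 1`, `2s < N`, `0 < μ < N`, `1 < p, q ≤ 2*_μ` and
bounded `Ω`, all the integrands are integrable for `u, v, φ, ψ` in `X(Ω)`, by the fractional
Sobolev and the Hardy-Littlewood-Sobolev inequalities. -/
def IsWeakSolution (s : ℝ) (Ω : Set (EuclideanSpace ℝ (Fin N))) (μ p q a b c ξ₁ ξ₂ : ℝ)
    (u v : EuclideanSpace ℝ (Fin N) → ℝ) : Prop :=
  MemX s Ω u ∧ MemX s Ω v ∧
    ∀ φ ψ : EuclideanSpace ℝ (Fin N) → ℝ, MemX s Ω φ → MemX s Ω ψ →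
      (innerX s u φ + innerX s v ψ)
        - (∫ x in Ω, ((a * u x + b * v x) * φ x + (b * u x + c * v x) * ψ x))
        - (∫ x in Ω, nonlinearity s Ω μ p q ξ₁ u v x * φ x)
        - (∫ x in Ω, nonlinearity s Ω μ q p ξ₂ v u x * ψ x) = 0

end FracChoquard

end

/-! The system is the rescaled Euler–Lagrange system of a maximization problem. Let `quadEnergy` be
the quadratic part of the energy and let `choquardEnergy` be the double integral of |u(x)|^p
|v(y)|^q / |x-y|^μ over Ω × Ω. The first is homogeneous of degree 2, the second of degree p + q > 2.
Since the largest eigenvalue of the matrix lies below the first eigenvalue of the fractional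
Laplacian, the quadratic energy controls both seminorms (`exists_pos_mul_le_quadEnergy`), so
maximizing the Choquard energy on {quadratic energy ≤ 1} is a bounded problem.

The maximum is attained (`Subcritical.exists_maximizer`) by compactness. A maximizing sequence
converges in L² and almost everywhere along a subsequence (`exists_subseq_tendsto`), and Fatou keeps
the constraint. The Choquard energy loses nothing in the limit because the exponents are strictly
subcritical: a power 1 + τ of its integrand is still bounded in L¹ (`Subcritical.exists_scaled`,
`le_integral_of_ae_tendsto`). These bounds rest on a fractional Sobolev inequality
(`exists_eLpNorm_sobExp_le`) and, in place of Hardy–Littlewood–Sobolev, on Young's inequality with a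
kernel truncated by the boundedness of Ω (`lintegral_mul_mul_kernel_le`).

Absolute values do not raise the quadratic energy, as b ≥ 0, so the maximizer may be taken
nonnegative. By homogeneity the maximum M gives D ≤ M Q^((p+q)/2) for all pairs, with equality at
the maximizer. Differentiating this inequality there yields both equations up to a factor
(`Subcritical.euler_lagrange`), and scaling the pair by one number t removes the factor. Each
component is then a nontrivial nonnegative supersolution of an equation with bounded zero-order
term, hence positive by the strong maximum principle (`ae_pos_of_supersolution`). -/

open Filter Topology
open scoped ENNReal NNReal

/-! ### Difference quotients and the space X(Ω). -/

noncomputable section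

namespace FracChoquard

variable {N : ℕ}

/-- The `s`-difference quotient `(u(x) - u(y)) / |x - y|^((N+2s)/2)`. -/
def diffQuot (s : ℝ) (u : EuclideanSpace ℝ (Fin N) → ℝ)
    (z : EuclideanSpace ℝ (Fin N) × EuclideanSpace ℝ (Fin N)) : ℝ :=
  (u z.1 - u z.2) / ‖z.1 - z.2‖ ^ (((N : ℝ) + 2 * s) / 2)

variable {s : ℝ} {Ω : Set (EuclideanSpace ℝ (Fin N))} {u v w φ : EuclideanSpace ℝ (Fin N) → ℝ}

lemma diffQuot_mul (u v : EuclideanSpace ℝ (Fin N) → ℝ)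
    (z : EuclideanSpace ℝ (Fin N) × EuclideanSpace ℝ (Fin N)) :
    diffQuot s u z * diffQuot s v z =
      ((u z.1 - u z.2) * (v z.1 - v z.2)) / ‖z.1 - z.2‖ ^ ((N : ℝ) + 2 * s) := by
  have h : ‖z.1 - z.2‖ ^ (((N : ℝ) + 2 * s) / 2) * ‖z.1 - z.2‖ ^ (((N : ℝ) + 2 * s) / 2)
      = ‖z.1 - z.2‖ ^ ((N : ℝ) + 2 * s) := by
    rw [← sq, ← Real.rpow_natCast, ← Real.rpow_mul (norm_nonneg _)]
    congr 1
    push_cast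
    ring
  rw [diffQuot, diffQuot, div_mul_div_comm, h]

lemma diffQuot_add (u v : EuclideanSpace ℝ (Fin N) → ℝ) :
    diffQuot s (u + v) = diffQuot s u + diffQuot s v := by
  ext z
  simp only [diffQuot, Pi.add_apply]
  ring

lemma diffQuot_smul (c : ℝ) (u : EuclideanSpace ℝ (Fin N) → ℝ) :
    diffQuot s (c • u) = c • diffQuot s u := by
  ext z
  simp only [diffQuot, Pi.smul_apply, smul_eq_mul]
  ring

lemma abs_diffQuot_le {z : EuclideanSpace ℝ (Fin N) × EuclideanSpace ℝ (Fin N)}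
    (h : |w z.1 - w z.2| ≤ |u z.1 - u z.2|) : |diffQuot s w z| ≤ |diffQuot s u z| := by
  rw [diffQuot, diffQuot, abs_div, abs_div]
  gcongr

lemma aestronglyMeasurable_diffQuot (hu : AEStronglyMeasurable u volume) :
    AEStronglyMeasurable (diffQuot s u) volume := by
  have h1 : AEStronglyMeasurable
      (fun z : EuclideanSpace ℝ (Fin N) × EuclideanSpace ℝ (Fin N) => u z.1) volume :=
    hu.comp_fst
  have h2 : AEStronglyMeasurable
      (fun z : EuclideanSpace ℝ (Fin N) × EuclideanSpace ℝ (Fin N) => u z.2) volume :=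
    hu.comp_snd
  have h3 : Measurable (fun z : EuclideanSpace ℝ (Fin N) × EuclideanSpace ℝ (Fin N) =>
      (‖z.1 - z.2‖ ^ (((N : ℝ) + 2 * s) / 2))) := by fun_prop
  exact ((h1.sub h2).aemeasurable.div h3.aemeasurable).aestronglyMeasurable

/-- Halving the exponent in the difference quotient turns the Gagliardo seminorm into an L² norm on
the product space, so that the L² theory gives all the bilinear estimates. -/
lemma memHs_iff : MemHs s u ↔ MemLp u 2 volume ∧ MemLp (diffQuot s u) 2 volume := by
  refine and_congr_right fun hu => ?_
  rw [memLp_two_iff_integrable_sq (aestronglyMeasurable_diffQuot hu.1)]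
  refine Eq.to_iff (congrArg (fun f => Integrable f volume) ?_)
  ext z
  rw [sq (diffQuot s u z), diffQuot_mul, sq]

lemma innerX_eq (u v : EuclideanSpace ℝ (Fin N) → ℝ) :
    innerX s u v = ∫ z, diffQuot s u z * diffQuot s v z := by
  simp only [innerX, diffQuot_mul]

lemma abs_clamp_sub_clamp_le (M a b : ℝ) :
    |max (-M) (min a M) - max (-M) (min b M)| ≤ |a - b| := by
  rw [max_comm, max_comm (-M)]
  refine (abs_max_sub_max_le_abs _ _ _).trans ?_
  simpa using abs_min_sub_min_le_max a M b M

namespace MemX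

lemma memLp (hu : MemX s Ω u) : MemLp u 2 volume := hu.1.1

lemma memLp_diffQuot (hu : MemX s Ω u) : MemLp (diffQuot s u) 2 volume := (memHs_iff.1 hu.1).2

lemma ae_eq_zero (hu : MemX s Ω u) : ∀ᵐ x ∂volume, x ∉ Ω → u x = 0 := hu.2

lemma mk' (h1 : MemLp u 2 volume) (h2 : MemLp (diffQuot s u) 2 volume)
    (h3 : ∀ᵐ x ∂volume, x ∉ Ω → u x = 0) : MemX s Ω u := ⟨memHs_iff.2 ⟨h1, h2⟩, h3⟩

lemma add (hu : MemX s Ω u) (hv : MemX s Ω v) : MemX s Ω (u + v) := by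
  refine mk' (hu.memLp.add hv.memLp) ?_ ?_
  · rw [diffQuot_add]
    exact hu.memLp_diffQuot.add hv.memLp_diffQuot
  · filter_upwards [hu.ae_eq_zero, hv.ae_eq_zero] with x h1 h2 hx
    simp [h1 hx, h2 hx]

lemma smul (c : ℝ) (hu : MemX s Ω u) : MemX s Ω (c • u) := by
  refine mk' (hu.memLp.const_smul c) ?_ ?_
  · rw [diffQuot_smul]
    exact hu.memLp_diffQuot.const_smul c
  · filter_upwards [hu.ae_eq_zero] with x h1 hx
    simp [h1 hx]

lemma sub (hu : MemX s Ω u) (hv : MemX s Ω v) : MemX s Ω (u - v) := by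
  have := hu.add (hv.smul (-1))
  rwa [neg_one_smul, ← sub_eq_add_neg] at this

/-- `X(Ω)` is stable under normal contractions. -/
lemma of_contraction (hu : MemX s Ω u) (hw : AEStronglyMeasurable w volume)
    (h1 : ∀ x, |w x| ≤ |u x|) (h2 : ∀ x y, |w x - w y| ≤ |u x - u y|) : MemX s Ω w := by
  refine mk' (hu.memLp.mono hw (.of_forall h1)) ?_ ?_
  · exact hu.memLp_diffQuot.mono (aestronglyMeasurable_diffQuot hw)
      (.of_forall fun z => abs_diffQuot_le (h2 _ _))
  · filter_upwards [hu.ae_eq_zero] with x h hx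
    simpa [h hx] using h1 x

lemma abs (hu : MemX s Ω u) : MemX s Ω (fun x => |u x|) :=
  hu.of_contraction (by simpa using hu.memLp.1.norm) (fun x => by simp)
    (fun x y => abs_abs_sub_abs_le_abs_sub _ _)

lemma posPart (hu : MemX s Ω u) : MemX s Ω (fun x => max (u x) 0) :=
  hu.of_contraction (hu.memLp.1.sup aestronglyMeasurable_const)
    (fun x => by
      rw [abs_of_nonneg (le_max_right _ _)]
      exact max_le (le_abs_self _) (abs_nonneg _))
    (fun x y => abs_max_sub_max_le_abs _ _ _)

lemma clamp (hu : MemX s Ω u) {M : ℝ} (hM : 0 ≤ M) :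
    MemX s Ω (fun x => max (-M) (min (u x) M)) := by
  refine hu.of_contraction (aestronglyMeasurable_const.sup
    (hu.memLp.1.inf aestronglyMeasurable_const)) (fun x => ?_) (fun x y => ?_)
  · have h1 := neg_abs_le (u x)
    have h2 := le_abs_self (u x)
    have h3 := abs_nonneg (u x)
    rw [abs_le]
    constructor
    · rcases le_total (-M) (-|u x|) with h | h
      · exact le_max_of_le_right (le_min h1 (by linarith))
      · exact le_max_of_le_left h
    · exact max_le (by linarith) ((min_le_left _ _).trans h2)
  · exact abs_clamp_sub_clamp_le M _ _

lemma integrable_mul (hu : MemX s Ω u) (hv : MemX s Ω v) :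
    Integrable (fun x => u x * v x) volume := MemLp.integrable_mul hu.memLp hv.memLp

lemma integrable_diffQuot_mul (hu : MemX s Ω u) (hv : MemX s Ω v) :
    Integrable (fun z => diffQuot s u z * diffQuot s v z) volume :=
  MemLp.integrable_mul hu.memLp_diffQuot hv.memLp_diffQuot

end MemX

lemma innerX_self_nonneg (u : EuclideanSpace ℝ (Fin N) → ℝ) : 0 ≤ innerX s u u := by
  rw [innerX_eq]
  exact integral_nonneg fun z => mul_self_nonneg _

lemma innerX_smul_left (c : ℝ) (u v : EuclideanSpace ℝ (Fin N) → ℝ) :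
    innerX s (c • u) v = c * innerX s u v := by
  rw [innerX_eq, innerX_eq, diffQuot_smul, ← integral_const_mul]
  simp [mul_assoc]

lemma innerX_comm (u v : EuclideanSpace ℝ (Fin N) → ℝ) : innerX s u v = innerX s v u := by
  simp only [innerX_eq, mul_comm]

lemma innerX_add_left (hu : MemX s Ω u) (hv : MemX s Ω v) (hw : MemX s Ω w) :
    innerX s (u + v) w = innerX s u w + innerX s v w := by
  rw [innerX_eq, innerX_eq, innerX_eq, diffQuot_add,
    ← integral_add (hu.integrable_diffQuot_mul hw) (hv.integrable_diffQuot_mul hw)]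
  simp [add_mul]

lemma innerX_add_smul_self (hu : MemX s Ω u) (hφ : MemX s Ω φ) (t : ℝ) :
    innerX s (u + t • φ) (u + t • φ) =
      innerX s u u + 2 * t * innerX s u φ + t ^ 2 * innerX s φ φ := by
  have ht := hφ.smul t
  rw [innerX_add_left hu ht (hu.add ht), innerX_comm u, innerX_comm (t • φ),
    innerX_add_left hu ht hu, innerX_add_left hu ht ht, innerX_comm u (t • φ),
    innerX_smul_left, innerX_smul_left, innerX_comm φ (t • φ), innerX_smul_left, innerX_comm φ u]
  ring

lemma innerX_smul_self (c : ℝ) (u : EuclideanSpace ℝ (Fin N) → ℝ) :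
    innerX s (c • u) (c • u) = c ^ 2 * innerX s u u := by
  rw [innerX_smul_left, innerX_comm, innerX_smul_left]
  ring

lemma innerX_self_mono (hu : MemX s Ω u) (h : ∀ x y, |w x - w y| ≤ |u x - u y|) :
    innerX s w w ≤ innerX s u u := by
  rw [innerX_eq, innerX_eq]
  refine integral_mono_of_nonneg (.of_forall fun z => mul_self_nonneg _)
    (hu.integrable_diffQuot_mul hu) (.of_forall fun z => ?_)
  have := abs_diffQuot_le (s := s) (h z.1 z.2)
  simpa only [sq] using sq_le_sq.2 this

lemma innerX_abs_self_le (hu : MemX s Ω u) :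
    innerX s (fun x => |u x|) (fun x => |u x|) ≤ innerX s u u :=
  innerX_self_mono hu fun _ _ => abs_abs_sub_abs_le_abs_sub _ _

lemma lintegral_diffQuot_sq (hu : MemX s Ω u) :
    ∫⁻ z, ENNReal.ofReal (diffQuot s u z ^ 2) = ENNReal.ofReal (innerX s u u) := by
  rw [innerX_eq, ofReal_integral_eq_lintegral_ofReal (hu.integrable_diffQuot_mul hu)
    (.of_forall fun z => mul_self_nonneg _)]
  simp only [sq]

end FracChoquard

end

/-! ### Explicit elements of X(Ω). -/

noncomputable section

namespace FracChoquard

variable {N : ℕ}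

lemma integrableOn_ball_norm_rpow_neg (hN : 1 ≤ N) {a : ℝ} (ha : a < N) (R : ℝ) :
    IntegrableOn (fun x : EuclideanSpace ℝ (Fin N) => ‖x‖ ^ (-a)) (Metric.ball 0 R) volume := by
  refine integrableOn_ball_of_norm_le_rpow (C := 1) (α := a) (by simpa using hN)
    (by simpa using ha) (.of_forall fun x => ?_) ?_
  · rw [one_mul, Real.norm_of_nonneg (by positivity)]
  · exact (by fun_prop : Measurable fun x : EuclideanSpace ℝ (Fin N) => ‖x‖ ^ (-a))
      |>.aestronglyMeasurable

variable {s : ℝ} {Ω : Set (EuclideanSpace ℝ (Fin N))}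

/-- This is the convolution kernel that dominates the Gagliardo integrand of a bounded Lipschitz
function. Near 0 it behaves like |z|^(2-N-2s), integrable since s < 1; at infinity like |z|^(-N-2s),
integrable since s > 0. -/
lemma integrable_min_sq_div_norm_rpow (hs0 : 0 < s) (hs1 : s < 1) (hN : 1 ≤ N) (C : ℝ) :
    Integrable (fun z : EuclideanSpace ℝ (Fin N) =>
      min (‖z‖ ^ 2) (C ^ 2) / ‖z‖ ^ ((N : ℝ) + 2 * s)) volume := by
  have hmeas : AEStronglyMeasurable (fun z : EuclideanSpace ℝ (Fin N) =>
      min (‖z‖ ^ 2) (C ^ 2) / ‖z‖ ^ ((N : ℝ) + 2 * s)) volume :=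
    (by fun_prop : Measurable _).aestronglyMeasurable
  have h0 : ∀ z : EuclideanSpace ℝ (Fin N),
      0 ≤ min (‖z‖ ^ 2) (C ^ 2) / ‖z‖ ^ ((N : ℝ) + 2 * s) := fun z =>
    div_nonneg (le_min (sq_nonneg _) (sq_nonneg _)) (by positivity)
  rw [← integrableOn_univ, ← Set.union_compl_self (Metric.ball (0 : EuclideanSpace ℝ (Fin N)) 1)]
  refine IntegrableOn.union ?_ ?_
  · refine Integrable.mono' (integrableOn_ball_norm_rpow_neg hN
      (a := (N : ℝ) + 2 * s - 2) (by linarith) 1) hmeas.restrict (.of_forall fun z => ?_)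
    rw [Real.norm_of_nonneg (h0 z)]
    rcases eq_or_lt_of_le (norm_nonneg z) with hz | hz
    · rw [← hz]
      rw [zero_pow two_ne_zero, min_eq_left (sq_nonneg C), zero_div]
      positivity
    · have : ‖z‖ ^ (-((N : ℝ) + 2 * s - 2)) = ‖z‖ ^ 2 / ‖z‖ ^ ((N : ℝ) + 2 * s) := by
        rw [← Real.rpow_natCast ‖z‖ 2, ← Real.rpow_sub hz]
        congr 1
        push_cast
        ring
      rw [this]
      gcongr
      exact min_le_left _ _
  · have hint : Integrable (fun z : EuclideanSpace ℝ (Fin N) =>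
        C ^ 2 * 2 ^ ((N : ℝ) + 2 * s) * (1 + ‖z‖) ^ (-((N : ℝ) + 2 * s))) volume :=
      (integrable_one_add_norm (by simpa using hs0)).const_mul _
    refine Integrable.mono' hint.integrableOn hmeas.restrict ?_
    filter_upwards [ae_restrict_mem Metric.isOpen_ball.measurableSet.compl] with z hz
    have hz1 : 1 ≤ ‖z‖ := by simpa using hz
    rw [Real.norm_of_nonneg (h0 z), Real.rpow_neg (by positivity), mul_assoc, div_eq_mul_inv]
    refine mul_le_mul (min_le_right _ _) ?_ (by positivity) (sq_nonneg C)
    rw [← div_eq_mul_inv, ← Real.div_rpow (by norm_num) (by positivity),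
      ← Real.inv_rpow (by positivity)]
    refine Real.rpow_le_rpow (by positivity) ?_ (by positivity)
    rw [inv_le_iff_one_le_mul₀ (by linarith), div_mul_eq_mul_div, le_div_iff₀ (by linarith)]
    linarith

/-- Bounded Lipschitz functions supported in a set of finite measure belong to `X(Ω)`. -/
lemma memX_of_lipschitz (hs0 : 0 < s) (hs1 : s < 1) (hN : 1 ≤ N) (hΩ : MeasurableSet Ω)
    (hΩf : volume Ω ≠ ∞) {η : EuclideanSpace ℝ (Fin N) → ℝ} (hη : LipschitzWith 1 η)
    {C : ℝ} (hC : ∀ x, 0 ≤ η x ∧ η x ≤ C) (h0 : ∀ x, x ∉ Ω → η x = 0) : MemX s Ω η := by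
  have hηm : AEStronglyMeasurable η volume := hη.continuous.aestronglyMeasurable
  refine MemX.mk' ?_ ?_ (.of_forall h0)
  · have h1 : MemLp (Ω.indicator fun _ => C) 2 volume := memLp_indicator_const 2 hΩ C (.inr hΩf)
    refine h1.mono hηm (.of_forall fun x => ?_)
    by_cases hx : x ∈ Ω
    · rw [Set.indicator_of_mem hx, Real.norm_of_nonneg (hC x).1]
      exact (hC x).2.trans (le_abs_self C)
    · simp [h0 x hx]
  · have hi : Integrable (Ω.indicator fun _ => (1 : ℝ)) volume :=
      (integrable_indicator_iff hΩ).2 (integrableOn_const hΩf)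
    -- The squared difference quotient is at most (1_Ω(x) + 1_Ω(y)) k(x - y) with k the kernel
    -- above, and each summand is a convolution integrand of two L¹ functions.
    have h1 := hi.convolution_integrand (ContinuousLinearMap.mul ℝ ℝ)
      (integrable_min_sq_div_norm_rpow (N := N) hs0 hs1 hN C)
    have h2 := h1.swap
    rw [memLp_two_iff_integrable_sq (aestronglyMeasurable_diffQuot hηm)]
    refine Integrable.mono' (h1.add h2) ((aestronglyMeasurable_diffQuot hηm).pow 2)
      (.of_forall fun z => ?_)
    rw [Real.norm_of_nonneg (sq_nonneg _), sq, diffQuot_mul, ← sq]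
    simp only [Pi.add_apply, Function.comp_apply, Prod.swap, ContinuousLinearMap.mul_apply']
    rw [← norm_sub_rev z.1 z.2, ← add_mul]
    have hle : (η z.1 - η z.2) ^ 2 ≤ min (‖z.1 - z.2‖ ^ 2) (C ^ 2) := by
      refine le_min ?_ ?_
      · have := hη.dist_le_mul z.1 z.2
        rw [NNReal.coe_one, one_mul, Real.dist_eq, dist_eq_norm] at this
        simpa using pow_le_pow_left₀ (abs_nonneg _) this 2
      · have h1 := hC z.1
        have h2 := hC z.2
        exact sq_le_sq' (by linarith) (by linarith)
    have hk : 0 ≤ min (‖z.1 - z.2‖ ^ 2) (C ^ 2) / ‖z.1 - z.2‖ ^ ((N : ℝ) + 2 * s) :=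
      div_nonneg (le_min (sq_nonneg _) (sq_nonneg _)) (by positivity)
    have hind : ∀ x, 0 ≤ Ω.indicator (fun _ => (1 : ℝ)) x :=
      fun x => Set.indicator_nonneg (fun _ _ => zero_le_one) x
    by_cases hz : z.1 ∈ Ω ∨ z.2 ∈ Ω
    · refine (div_le_div_of_nonneg_right hle (by positivity)).trans (le_mul_of_one_le_left hk ?_)
      rcases hz with hz | hz
      · rw [Set.indicator_of_mem hz]
        linarith [hind z.2]
      · rw [Set.indicator_of_mem hz]
        linarith [hind z.1]
    · push Not at hz
      rw [h0 _ hz.1, h0 _ hz.2]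
      simp only [sub_self, ne_eq, OfNat.ofNat_ne_zero, not_false_eq_true, zero_pow, zero_div]
      exact mul_nonneg (add_nonneg (hind _) (hind _)) hk

/-- A bounded open set carries a function of `X(Ω)` that is positive exactly in `Ω`. -/
lemma exists_memX_pos (hs0 : 0 < s) (hs1 : s < 1) (hN : 1 ≤ N) (hΩ : IsOpen Ω)
    (hΩb : Bornology.IsBounded Ω) : ∃ (η : EuclideanSpace ℝ (Fin N) → ℝ) (C : ℝ), MemX s Ω η ∧
      Measurable η ∧ (∀ x, 0 ≤ η x ∧ η x ≤ C) ∧ (∀ x ∈ Ω, 0 < η x) ∧ ∀ x ∉ Ω, η x = 0 := by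
  have : Nontrivial (EuclideanSpace ℝ (Fin N)) := by
    refine Module.nontrivial_of_finrank_pos (R := ℝ) ?_
    rw [finrank_euclideanSpace_fin]
    exact hN
  -- The witness will be the distance to the complement, which is positive in Ω only if the
  -- complement is nonempty: `Metric.infDist` to the empty set is 0.
  have hne : (Ωᶜ).Nonempty := by
    rw [Set.nonempty_compl]
    rintro rfl
    exact NormedSpace.unbounded_univ ℝ (EuclideanSpace ℝ (Fin N)) hΩb
  obtain ⟨z, hz⟩ := hne
  obtain ⟨C, hC⟩ := hΩb.subset_closedBall z
  have h0 : ∀ x ∉ Ω, Metric.infDist x Ωᶜ = 0 := fun x hx => Metric.infDist_zero_of_mem hx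
  have hb : ∀ x, 0 ≤ Metric.infDist x Ωᶜ ∧ Metric.infDist x Ωᶜ ≤ max C 0 := by
    refine fun x => ⟨Metric.infDist_nonneg, ?_⟩
    by_cases hx : x ∈ Ω
    · exact (Metric.infDist_le_dist_of_mem hz).trans ((hC hx).trans (le_max_left _ _))
    · rw [h0 x hx]
      exact le_max_right _ _
  refine ⟨fun x => Metric.infDist x Ωᶜ, max C 0,
    memX_of_lipschitz hs0 hs1 hN hΩ.measurableSet hΩb.measure_lt_top.ne
      (Metric.lipschitz_infDist_pt _) hb h0,
    (Metric.continuous_infDist_pt _).measurable, hb, fun x hx => ?_, h0⟩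
  exact (hΩ.isClosed_compl.notMem_iff_infDist_pos ⟨z, hz⟩).1 (by simpa using hx)

end FracChoquard

end

/-! ### The fractional Sobolev inequality. -/

noncomputable section

namespace FracChoquard

variable {N : ℕ} {s : ℝ} {Ω : Set (EuclideanSpace ℝ (Fin N))} {u : EuclideanSpace ℝ (Fin N) → ℝ}

/-- The critical fractional Sobolev exponent `2N / (N - 2s)`. -/
def sobExp (N : ℕ) (s : ℝ) : ℝ := 2 * (N : ℝ) / ((N : ℝ) - 2 * s)

lemma two_lt_sobExp (hs0 : 0 < s) (hN : 2 * s < (N : ℝ)) : 2 < sobExp N s := by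
  rw [sobExp, lt_div_iff₀ (by linarith)]
  linarith

/-- The optimization over the radius in the proof of the fractional Sobolev inequality. -/
lemma rpow_sobExp_le_of_forall_radius (hs0 : 0 < s) (hN : 2 * s < (N : ℝ))
    {U d m c₁ c₂ : ℝ} (hU : 0 ≤ U) (hd : 0 ≤ d) (hm : 0 < m) (hc₁ : 0 ≤ c₁) (hc₂ : 0 ≤ c₂)
    (h : ∀ r > 0, U ≤ c₁ * r ^ s * d + c₂ * r ^ (-(((N : ℝ) - 2 * s) / 2)) * m) :
    U ^ sobExp N s ≤ (c₁ + c₂) ^ sobExp N s * d ^ 2 * m ^ (sobExp N s - 2) := by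
  have hN0 : (0 : ℝ) < N := by linarith
  have hN2 : (0 : ℝ) < N - 2 * s := by linarith
  have hq : 0 < sobExp N s := by linarith [two_lt_sobExp hs0 hN]
  rcases hd.eq_or_lt with rfl | hd
  -- For d = 0 no radius balances the two terms; letting r → ∞ forces U = 0.
  · have hlim : Tendsto (fun r : ℝ => c₁ * r ^ s * 0 + c₂ * r ^ (-(((N : ℝ) - 2 * s) / 2)) * m)
        atTop (𝓝 (c₂ * 0 * m)) := by
      simp only [mul_zero, zero_add]
      simpa using ((tendsto_rpow_neg_atTop (y := ((N : ℝ) - 2 * s) / 2)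
        (by linarith)).const_mul c₂).mul_const m
    have : U ≤ c₂ * 0 * m := ge_of_tendsto hlim
      ((eventually_gt_atTop 0).mono fun r hr => h r hr)
    have hU0 : U = 0 := le_antisymm (by simpa using this) hU
    rw [hU0, Real.zero_rpow hq.ne']
    positivity
  -- This radius makes r^s d equal to r^(-(N-2s)/2) m.
  · have hr : 0 < (m / d) ^ (2 / (N : ℝ)) := by positivity
    have h1 := h _ hr
    have e1 : ((m / d) ^ (2 / (N : ℝ))) ^ s * d = m ^ (2 * s / N) * d ^ (((N : ℝ) - 2 * s) / N) := by
      rw [← Real.rpow_mul (by positivity), Real.div_rpow hm.le hd.le, div_mul_eq_mul_div,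
        mul_div_assoc, show ((N : ℝ) - 2 * s) / N = 1 - 2 / N * s by field_simp,
        Real.rpow_sub hd, Real.rpow_one, show 2 * s / (N : ℝ) = 2 / N * s by ring]
    have e2 : ((m / d) ^ (2 / (N : ℝ))) ^ (-(((N : ℝ) - 2 * s) / 2)) * m
        = m ^ (2 * s / N) * d ^ (((N : ℝ) - 2 * s) / N) := by
      rw [← Real.rpow_mul (by positivity), Real.div_rpow hm.le hd.le]
      have : (2 / (N : ℝ)) * (-(((N : ℝ) - 2 * s) / 2)) = -(((N : ℝ) - 2 * s) / N) := by
        field_simp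
      rw [this, Real.rpow_neg hd.le, div_inv_eq_mul, mul_right_comm]
      nth_rewrite 2 [← Real.rpow_one m]
      rw [← Real.rpow_add hm]
      congr 2
      field_simp
      ring
    have h2 : U ≤ (c₁ + c₂) * (m ^ (2 * s / N) * d ^ (((N : ℝ) - 2 * s) / N)) := by
      rw [mul_assoc, e1, mul_assoc, e2] at h1
      linarith
    refine (Real.rpow_le_rpow hU h2 hq.le).trans (le_of_eq ?_)
    rw [Real.mul_rpow (by positivity) (by positivity), Real.mul_rpow (by positivity) (by positivity),
      ← Real.rpow_mul hm.le, ← Real.rpow_mul hd.le, mul_assoc]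
    have e3 : 2 * s / N * sobExp N s = sobExp N s - 2 := by
      rw [sobExp]
      field_simp
      ring
    have e4 : ((N : ℝ) - 2 * s) / N * sobExp N s = (2 : ℕ) := by
      rw [sobExp]
      field_simp
      norm_num
    rw [e3, e4, Real.rpow_natCast, mul_comm (d ^ 2)]

/-- A pointwise bound by an average over a ball. -/
lemma enorm_mul_measure_ball_le (hs0 : 0 < s) (hN : 2 * s < (N : ℝ))
    (hu : AEStronglyMeasurable u volume) (x : EuclideanSpace ℝ (Fin N)) (r : ℝ) :
    ‖u x‖ₑ * volume (Metric.ball x r) ^ (1 / 2 : ℝ) ≤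
      ENNReal.ofReal (r ^ (((N : ℝ) + 2 * s) / 2)) *
        eLpNorm (fun y => diffQuot s u (x, y)) 2 volume +
      eLpNorm u (ENNReal.ofReal (sobExp N s)) volume *
        volume (Metric.ball x r) ^ (1 / 2 - 1 / sobExp N s) := by
  have hq := two_lt_sobExp hs0 hN
  set ν := volume.restrict (Metric.ball x r) with hν
  have hνu : ν Set.univ = volume (Metric.ball x r) := by simp [hν]
  have hle : ν ≤ volume := Measure.restrict_le_self
  have hm1 : AEStronglyMeasurable (fun y => u x - u y) ν :=
    aestronglyMeasurable_const.sub hu.restrict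
  -- On the ball the constant u(x) is (u(x) - u(y)) + u(y). The first term is bounded through |x -
  -- y| < r, the second by Hölder.
  have h1 : eLpNorm (fun _ => u x) 2 ν ≤ eLpNorm (fun y => u x - u y) 2 ν + eLpNorm u 2 ν := by
    refine le_trans (le_of_eq ?_) (eLpNorm_add_le hm1 hu.restrict (by norm_num))
    congr 1
    ext y
    simp only [Pi.add_apply, sub_add_cancel]
  have h2 : eLpNorm (fun y => u x - u y) 2 ν ≤ ENNReal.ofReal (r ^ (((N : ℝ) + 2 * s) / 2)) *
        eLpNorm (fun y => diffQuot s u (x, y)) 2 volume := by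
    refine (eLpNorm_le_mul_eLpNorm_of_ae_le_mul (c := r ^ (((N : ℝ) + 2 * s) / 2))
      (g := fun y => diffQuot s u (x, y)) ?_ 2).trans ?_
    · filter_upwards [ae_restrict_mem Metric.isOpen_ball.measurableSet] with y hy
      simp only [diffQuot, norm_div]
      rcases eq_or_ne x y with rfl | hxy
      · simp
      · have hp : 0 < ‖x - y‖ := norm_pos_iff.2 (sub_ne_zero.2 hxy)
        rw [Real.norm_of_nonneg (by positivity : (0 : ℝ) ≤ ‖x - y‖ ^ (((N : ℝ) + 2 * s) / 2)),
          mul_div_assoc', le_div_iff₀ (by positivity), mul_comm]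
        gcongr
        rw [← dist_eq_norm, dist_comm]
        exact (Metric.mem_ball.1 hy).le
    · gcongr
  have h3 : eLpNorm u 2 ν ≤ eLpNorm u (ENNReal.ofReal (sobExp N s)) volume *
        volume (Metric.ball x r) ^ (1 / 2 - 1 / sobExp N s) := by
    have := eLpNorm_le_eLpNorm_mul_rpow_measure_univ (μ := ν) (p := 2)
      (q := ENNReal.ofReal (sobExp N s)) (f := u) (by
        rw [← ENNReal.ofReal_ofNat]
        exact ENNReal.ofReal_le_ofReal hq.le) hu.restrict
    rw [hνu, ENNReal.toReal_ofReal (by linarith), ENNReal.toReal_ofNat] at this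
    refine this.trans ?_
    gcongr
  have h4 : eLpNorm (fun _ => u x) 2 ν = ‖u x‖ₑ * volume (Metric.ball x r) ^ (1 / 2 : ℝ) := by
    rw [eLpNorm_const' _ (by norm_num) (by norm_num), hνu, ENNReal.toReal_ofNat]
  rw [← h4]
  exact h1.trans (add_le_add h2 h3)

/-- Dividing the ball estimate by |B_r|^(1/2) and choosing the best radius at each point gives a
bound whose right side depends on x only through the square of the local difference quotient, so
that it can be integrated in x. -/
lemma exists_enorm_rpow_sobExp_le (hs0 : 0 < s) (hN : 2 * s < (N : ℝ)) : ∃ C : ℝ, 0 ≤ C ∧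
    ∀ u : EuclideanSpace ℝ (Fin N) → ℝ, AEStronglyMeasurable u volume →
      eLpNorm u (ENNReal.ofReal (sobExp N s)) volume ≠ 0 →
      eLpNorm u (ENNReal.ofReal (sobExp N s)) volume ≠ ∞ → ∀ x,
      ‖u x‖ₑ ^ sobExp N s ≤ ENNReal.ofReal C *
        eLpNorm (fun y => diffQuot s u (x, y)) 2 volume ^ 2 *
          eLpNorm u (ENNReal.ofReal (sobExp N s)) volume ^ (sobExp N s - 2) := by
  have hN0 : (0 : ℝ) < N := by linarith
  have hN2 : (0 : ℝ) < N - 2 * s := by linarith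
  have hq := two_lt_sobExp hs0 hN
  set ω : ℝ := volume.real (Metric.ball (0 : EuclideanSpace ℝ (Fin N)) 1) with hω
  have hω0 : 0 < ω := by
    rw [hω, measureReal_def]
    exact ENNReal.toReal_pos (Metric.measure_ball_pos _ _ one_pos).ne' measure_ball_lt_top.ne
  refine ⟨(ω ^ (-(1 / 2) : ℝ) + ω ^ (-(1 / sobExp N s))) ^ sobExp N s, by positivity,
    fun u hu hm0 hmt x => ?_⟩
  set m := eLpNorm u (ENNReal.ofReal (sobExp N s)) volume with hmdef
  set d := eLpNorm (fun y => diffQuot s u (x, y)) 2 volume with hd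
  have hm : 0 < m.toReal := ENNReal.toReal_pos hm0 hmt
  -- In this case the right side is infinite, because m ≠ 0 and the constant is positive.
  by_cases hdt : d = ∞
  · have h0 : m ^ (sobExp N s - 2) ≠ 0 := by
      simp only [ne_eq, ENNReal.rpow_eq_zero_iff, not_or, not_and]
      exact ⟨fun h => absurd h hm0, fun h => absurd h hmt⟩
    have h1 : ENNReal.ofReal
        ((ω ^ (-(1 / 2) : ℝ) + ω ^ (-(1 / sobExp N s))) ^ sobExp N s) ≠ 0 := by
      rw [ne_eq, ENNReal.ofReal_eq_zero, not_le]
      positivity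
    rw [hdt, ENNReal.top_pow two_ne_zero, ENNReal.mul_top h1, ENNReal.top_mul h0]
    exact le_top
  have key := rpow_sobExp_le_of_forall_radius (N := N) (s := s) (U := |u x|) (d := d.toReal)
    (m := m.toReal) (c₁ := ω ^ (-(1 / 2) : ℝ)) (c₂ := ω ^ (-(1 / sobExp N s))) hs0 hN
    (abs_nonneg _) ENNReal.toReal_nonneg hm (by positivity) (by positivity) (fun r hr => by
      have h1 := enorm_mul_measure_ball_le (s := s) hs0 hN hu x r
      have hvol : volume (Metric.ball x r) = ENNReal.ofReal (r ^ (N : ℝ) * ω) := by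
        rw [Measure.addHaar_ball_of_pos _ _ hr, ENNReal.ofReal_mul (by positivity), hω,
          ofReal_measureReal, finrank_euclideanSpace_fin, Real.rpow_natCast]
      have hV : 0 < r ^ (N : ℝ) * ω := by positivity
      rw [hvol, ENNReal.ofReal_rpow_of_pos hV, ENNReal.ofReal_rpow_of_pos hV, Real.enorm_eq_ofReal_abs,
        ← ENNReal.ofReal_mul (abs_nonneg _), ← hd, ← hmdef, ← ENNReal.ofReal_toReal hdt,
        ← ENNReal.ofReal_toReal hmt, ← ENNReal.ofReal_mul (by positivity),
        ← ENNReal.ofReal_mul (by positivity), ← ENNReal.ofReal_add (by positivity) (by positivity),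
        ENNReal.ofReal_le_ofReal_iff (by positivity)] at h1
      have hVp : 0 < (r ^ (N : ℝ) * ω) ^ (1 / 2 : ℝ) := by positivity
      have e1 : r ^ (((N : ℝ) + 2 * s) / 2) =
          ω ^ (-(1 / 2) : ℝ) * r ^ s * (r ^ (N : ℝ) * ω) ^ (1 / 2 : ℝ) := by
        rw [Real.mul_rpow (by positivity) hω0.le, ← Real.rpow_mul hr.le,
          show ω ^ (-(1 / 2) : ℝ) * r ^ s * (r ^ ((N : ℝ) * (1 / 2)) * ω ^ (1 / 2 : ℝ)) =
            (ω ^ (-(1 / 2) : ℝ) * ω ^ (1 / 2 : ℝ)) * (r ^ s * r ^ ((N : ℝ) * (1 / 2))) by ring,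
          ← Real.rpow_add hω0, ← Real.rpow_add hr]
        norm_num
        congr 1
        ring
      have e2 : (r ^ (N : ℝ) * ω) ^ (1 / 2 - 1 / sobExp N s) =
          ω ^ (-(1 / sobExp N s)) * r ^ (-(((N : ℝ) - 2 * s) / 2)) *
            (r ^ (N : ℝ) * ω) ^ (1 / 2 : ℝ) := by
        rw [sub_eq_neg_add, Real.rpow_add hV, Real.mul_rpow (by positivity) hω0.le,
          ← Real.rpow_mul hr.le, mul_comm (r ^ _)]
        congr 3
        rw [sobExp]
        field_simp
      rw [e1, e2] at h1
      refine le_of_mul_le_mul_right (h1.trans (le_of_eq ?_)) hVp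
      ring)
  have := ENNReal.ofReal_le_ofReal key
  rw [ENNReal.ofReal_mul (by positivity), ENNReal.ofReal_mul (by positivity),
    ENNReal.ofReal_pow ENNReal.toReal_nonneg, ENNReal.ofReal_toReal hdt,
    ← ENNReal.ofReal_rpow_of_pos hm, ENNReal.ofReal_toReal hmt,
    ← ENNReal.ofReal_rpow_of_nonneg (abs_nonneg _) (by linarith),
    ← Real.enorm_eq_ofReal_abs] at this
  exact this

lemma lintegral_eLpNorm_diffQuot_sq (hu : MemX s Ω u) :
    ∫⁻ x, eLpNorm (fun y => diffQuot s u (x, y)) 2 volume ^ 2 =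
      ENNReal.ofReal (innerX s u u) := by
  rw [← lintegral_diffQuot_sq hu, Measure.volume_eq_prod, lintegral_prod]
  · refine lintegral_congr fun x => ?_
    rw [eLpNorm_eq_lintegral_rpow_enorm_toReal (by norm_num) (by norm_num), ENNReal.toReal_ofNat,
      ← ENNReal.rpow_natCast, ← ENNReal.rpow_mul]
    simp only [Nat.cast_ofNat, one_div, isUnit_iff_ne_zero, ne_eq, OfNat.ofNat_ne_zero,
      not_false_eq_true, IsUnit.inv_mul_cancel, ENNReal.rpow_one]
    refine lintegral_congr fun y => ?_
    rw [Real.enorm_eq_ofReal_abs, ENNReal.rpow_ofNat, ← ENNReal.ofReal_pow (abs_nonneg _), sq_abs]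
  · exact ((aestronglyMeasurable_diffQuot hu.memLp.1).pow 2).aemeasurable.ennreal_ofReal

/-- The fractional Sobolev inequality, at the critical exponent. -/
theorem exists_eLpNorm_sobExp_le (hs0 : 0 < s) (hN : 2 * s < (N : ℝ)) : ∃ C : ℝ, 0 ≤ C ∧
    ∀ (Ω : Set (EuclideanSpace ℝ (Fin N))) (u : EuclideanSpace ℝ (Fin N) → ℝ),
      MeasurableSet Ω → volume Ω ≠ ∞ → MemX s Ω u →
      eLpNorm u (ENNReal.ofReal (sobExp N s)) volume ≤
        ENNReal.ofReal (C * √(innerX s u u)) := by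
  have hq := two_lt_sobExp hs0 hN
  obtain ⟨C, hC0, hC⟩ := exists_enorm_rpow_sobExp_le (N := N) (s := s) hs0 hN
  -- Integrating the pointwise bound gives m^q ≤ C [u]² m^(q-2), with m the norm and q the critical
  -- exponent; cancelling m^(q-2) requires m finite.
  have hfin : ∀ (Ω : Set (EuclideanSpace ℝ (Fin N))) (u : EuclideanSpace ℝ (Fin N) → ℝ),
      MemX s Ω u → eLpNorm u (ENNReal.ofReal (sobExp N s)) volume ≠ ∞ →
      eLpNorm u (ENNReal.ofReal (sobExp N s)) volume ≤
        ENNReal.ofReal (√C * √(innerX s u u)) := by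
    intro Ω u hu hmt
    by_cases hm0 : eLpNorm u (ENNReal.ofReal (sobExp N s)) volume = 0
    · rw [hm0]
      exact bot_le
    set m := eLpNorm u (ENNReal.ofReal (sobExp N s)) volume with hm
    have h1 : m ^ sobExp N s = ∫⁻ x, ‖u x‖ₑ ^ sobExp N s := by
      rw [hm, eLpNorm_eq_lintegral_rpow_enorm_toReal
        (by rw [ne_eq, ENNReal.ofReal_eq_zero]; linarith) ENNReal.ofReal_ne_top,
        ENNReal.toReal_ofReal (by linarith), ← ENNReal.rpow_mul, one_div,
        inv_mul_cancel₀ (by linarith), ENNReal.rpow_one]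
    have h2 : m ^ sobExp N s ≤ ENNReal.ofReal C * ENNReal.ofReal (innerX s u u) *
        m ^ (sobExp N s - 2) := by
      rw [h1]
      refine (lintegral_mono (hC u hu.memLp.1 hm0 hmt)).trans ?_
      have hfin1 : m ^ (sobExp N s - 2) ≠ ∞ :=
        ENNReal.rpow_ne_top_of_nonneg (by linarith) hmt
      rw [lintegral_mul_const' _ _ hfin1, lintegral_const_mul' _ _ ENNReal.ofReal_ne_top,
        lintegral_eLpNorm_diffQuot_sq hu]
    have h3 : m ^ sobExp N s = m ^ 2 * m ^ (sobExp N s - 2) := by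
      rw [← ENNReal.rpow_natCast, ← ENNReal.rpow_add _ _ hm0 hmt]
      congr 1
      push_cast
      ring
    have h5 : m ^ 2 ≤ ENNReal.ofReal C * ENNReal.ofReal (innerX s u u) := by
      rw [h3] at h2
      refine (ENNReal.mul_le_mul_iff_left ?_ ?_).1 h2
      · simp only [ne_eq, ENNReal.rpow_eq_zero_iff, not_or, not_and]
        exact ⟨fun h => absurd h hm0, fun h => absurd h hmt⟩
      · exact ENNReal.rpow_ne_top_of_nonneg (by linarith) hmt
    rw [← Real.sqrt_mul hC0, ← ENNReal.ofReal_toReal hmt]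
    refine ENNReal.ofReal_le_ofReal (Real.le_sqrt_of_sq_le ?_)
    rw [← ENNReal.ofReal_mul hC0] at h5
    have := ENNReal.toReal_mono ENNReal.ofReal_ne_top h5
    rwa [ENNReal.toReal_pow, ENNReal.toReal_ofReal
      (mul_nonneg hC0 (innerX_self_nonneg u))] at this
  refine ⟨√C, Real.sqrt_nonneg _, fun Ω u hΩ hΩf hu => ?_⟩
  -- Truncations are bounded and vanish outside a set of finite measure, so their norms are finite;
  -- their seminorms do not exceed that of u, and Fatou passes to the limit.
  let f : ℕ → EuclideanSpace ℝ (Fin N) → ℝ := fun M x => max (-(M : ℝ)) (min (u x) M)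
  have hf : ∀ M, MemX s Ω (f M) := fun M => hu.clamp (Nat.cast_nonneg M)
  refine Lp.eLpNorm_le_of_ae_tendsto (u := atTop) (f := f) (.of_forall fun M => ?_)
    (fun M => (hf M).memLp.1) (.of_forall fun x => ?_)
  · refine (hfin Ω (f M) (hf M) ?_).trans ?_
    · have h1 : MemLp (Ω.indicator fun _ => (M : ℝ)) (ENNReal.ofReal (sobExp N s)) volume :=
        memLp_indicator_const _ hΩ _ (.inr hΩf)
      refine (h1.mono (hf M).memLp.1 ?_).2.ne
      filter_upwards [(hf M).ae_eq_zero] with x hx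
      by_cases hxΩ : x ∈ Ω
      · rw [Set.indicator_of_mem hxΩ]
        have hM : (0 : ℝ) ≤ M := Nat.cast_nonneg M
        rw [Real.norm_of_nonneg hM, Real.norm_eq_abs, abs_le]
        exact ⟨le_max_left _ _, max_le (by linarith) (min_le_right _ _)⟩
      · simp [hx hxΩ]
    · gcongr
      exact innerX_self_mono hu fun x y => abs_clamp_sub_clamp_le _ _ _
  · obtain ⟨K, hK⟩ := exists_nat_ge |u x|
    refine tendsto_const_nhds.congr' ?_
    filter_upwards [eventually_ge_atTop K] with M hM
    have hM' : |u x| ≤ M := hK.trans (by exact_mod_cast hM)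
    rw [abs_le] at hM'
    simp only [f]
    rw [min_eq_left hM'.2, max_eq_right hM'.1]

/-- The subcritical Sobolev embedding in sets of finite measure. -/
theorem exists_lintegral_rpow_le (hs0 : 0 < s) (hN : 2 * s < (N : ℝ)) (hΩ : MeasurableSet Ω)
    (hΩf : volume Ω ≠ ∞) {r : ℝ} (hr0 : 0 < r) (hr : r ≤ sobExp N s) : ∃ C : ℝ, 0 ≤ C ∧
    ∀ u : EuclideanSpace ℝ (Fin N) → ℝ, MemX s Ω u →
      ∫⁻ x in Ω, ENNReal.ofReal (|u x| ^ r) ≤ ENNReal.ofReal (C * √(innerX s u u) ^ r) := by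
  have hq := two_lt_sobExp hs0 hN
  obtain ⟨C, hC0, hC⟩ := exists_eLpNorm_sobExp_le (N := N) (s := s) hs0 hN
  set V : ℝ := volume.real Ω ^ (1 / r - 1 / sobExp N s)
  have hexp : 0 ≤ 1 / r - 1 / sobExp N s := sub_nonneg.2 (one_div_le_one_div_of_le hr0 hr)
  have hV0 : 0 ≤ V := by positivity
  refine ⟨(C * V) ^ r, by positivity, fun u hu => ?_⟩
  have h1 := eLpNorm_le_eLpNorm_mul_rpow_measure_univ (μ := volume.restrict Ω)
    (ENNReal.ofReal_le_ofReal hr) hu.memLp.1.restrict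
  rw [ENNReal.toReal_ofReal hr0.le, ENNReal.toReal_ofReal (by linarith),
    Measure.restrict_apply_univ] at h1
  have h2 : eLpNorm u (ENNReal.ofReal r) (volume.restrict Ω) ≤
      ENNReal.ofReal (C * V * √(innerX s u u)) := by
    refine h1.trans ?_
    rw [mul_right_comm, ENNReal.ofReal_mul (by positivity),
      ← ENNReal.ofReal_rpow_of_nonneg measureReal_nonneg hexp, ofReal_measureReal hΩf]
    gcongr
    exact (eLpNorm_mono_measure _ Measure.restrict_le_self).trans (hC Ω u hΩ hΩf hu)
  rw [eLpNorm_eq_lintegral_rpow_enorm_toReal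
    (by rw [ne_eq, ENNReal.ofReal_eq_zero]; linarith) ENNReal.ofReal_ne_top,
    ENNReal.toReal_ofReal hr0.le] at h2
  have h3 := ENNReal.rpow_le_rpow h2 hr0.le
  rw [← ENNReal.rpow_mul, one_div, inv_mul_cancel₀ hr0.ne', ENNReal.rpow_one,
    ENNReal.ofReal_rpow_of_nonneg (by positivity) hr0.le,
    Real.mul_rpow (by positivity) (by positivity)] at h3
  refine le_trans (le_of_eq (lintegral_congr fun x => ?_)) h3
  rw [Real.enorm_eq_ofReal_abs, ENNReal.ofReal_rpow_of_nonneg (abs_nonneg _) hr0.le]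

end FracChoquard

end

/-! ### Bounds for the Choquard energy. -/

noncomputable section

namespace FracChoquard

/-- Young's inequality for a bilinear form with an integral kernel. -/
lemma lintegral_mul_mul_kernel_le {α : Type*} [MeasurableSpace α] {ν : Measure α} [SFinite ν]
    {f g : α → ℝ≥0∞} {k : α × α → ℝ≥0∞} (hf : AEMeasurable f ν) (hg : AEMeasurable g ν)
    (hk : Measurable k) {θ : ℝ} (hθ : 1 / 2 < θ) (hθ1 : θ < 1) {A : ℝ≥0∞}
    (hA₁ : ∀ᵐ x ∂ν, ∫⁻ y, k (x, y) ^ (1 / (2 - 2 * θ)) ∂ν ≤ A)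
    (hA₂ : ∀ᵐ y ∂ν, ∫⁻ x, k (x, y) ^ (1 / (2 - 2 * θ)) ∂ν ≤ A) :
    ∫⁻ z, f z.1 * g z.2 * k z ∂(ν.prod ν) ≤
      A ^ (2 - 2 * θ) * (∫⁻ x, f x ^ (1 / θ) ∂ν) ^ θ * (∫⁻ x, g x ^ (1 / θ) ∂ν) ^ θ := by
  have hθ0 : 0 < θ := by linarith
  have h1θ : 0 < 1 - θ := by linarith
  have h2θ : 0 < 2 - 2 * θ := by linarith
  have hθp : 0 < 1 / θ := by positivity
  set σ : ℝ := 1 / (2 - 2 * θ) with hσ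
  have hσ0 : 0 < σ := by positivity
  have hfm : AEMeasurable (fun z : α × α => f z.1 ^ (1 / θ)) (ν.prod ν) :=
    (hf.comp_quasiMeasurePreserving Measure.quasiMeasurePreserving_fst).pow_const _
  have hgm : AEMeasurable (fun z : α × α => g z.2 ^ (1 / θ)) (ν.prod ν) :=
    (hg.comp_quasiMeasurePreserving Measure.quasiMeasurePreserving_snd).pow_const _
  have hkm : Measurable (fun z : α × α => k z ^ σ) := hk.pow_const _
  -- Hölder with three factors of weights 1-θ, 1-θ, 2θ-1. The kernel enters two of them, and its
  -- total power is σ(2-2θ) = 1.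
  let F : Fin 3 → α × α → ℝ≥0∞ := ![fun z => f z.1 ^ (1 / θ) * k z ^ σ,
    fun z => g z.2 ^ (1 / θ) * k z ^ σ, fun z => f z.1 ^ (1 / θ) * g z.2 ^ (1 / θ)]
  have hF : ∀ i ∈ (Finset.univ : Finset (Fin 3)), AEMeasurable (F i) (ν.prod ν) := by
    intro i _
    fin_cases i
    · exact hfm.mul hkm.aemeasurable
    · exact hgm.mul hkm.aemeasurable
    · exact hfm.mul hgm
  have hol := ENNReal.lintegral_prod_norm_pow_le (μ := ν.prod ν) Finset.univ hF
    (p := ![1 - θ, 1 - θ, 2 * θ - 1])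
    (by simp [Fin.sum_univ_three]; ring)
    (by intro i _; fin_cases i <;> simp <;> linarith)
  simp only [Fin.prod_univ_three, F, Matrix.cons_val_zero, Matrix.cons_val_one,
    Matrix.cons_val] at hol
  have hpt : ∀ z : α × α, (f z.1 ^ (1 / θ) * k z ^ σ) ^ (1 - θ) *
      (g z.2 ^ (1 / θ) * k z ^ σ) ^ (1 - θ) *
      (f z.1 ^ (1 / θ) * g z.2 ^ (1 / θ)) ^ (2 * θ - 1) = f z.1 * g z.2 * k z := by
    intro z
    have h2 : (0 : ℝ) ≤ 2 * θ - 1 := by linarith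
    rw [ENNReal.mul_rpow_of_nonneg _ _ h1θ.le, ENNReal.mul_rpow_of_nonneg _ _ h1θ.le,
      ENNReal.mul_rpow_of_nonneg _ _ h2]
    simp only [← ENNReal.rpow_mul]
    have hc : ∀ a : ℝ≥0∞, a ^ (1 / θ * (1 - θ)) * a ^ (1 / θ * (2 * θ - 1)) = a := by
      intro a
      rw [← ENNReal.rpow_add_of_nonneg _ _ (by positivity) (by positivity), ← mul_add]
      rw [show 1 - θ + (2 * θ - 1) = θ by ring, one_div, inv_mul_cancel₀ hθ0.ne', ENNReal.rpow_one]
    have hd : ∀ a : ℝ≥0∞, a ^ (σ * (1 - θ)) * a ^ (σ * (1 - θ)) = a := by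
      intro a
      rw [← ENNReal.rpow_add_of_nonneg _ _ (by positivity) (by positivity), ← mul_add,
        show 1 - θ + (1 - θ) = 2 - 2 * θ by ring, hσ, one_div, inv_mul_cancel₀ h2θ.ne',
        ENNReal.rpow_one]
    calc _ = (f z.1 ^ (1 / θ * (1 - θ)) * f z.1 ^ (1 / θ * (2 * θ - 1))) *
          (g z.2 ^ (1 / θ * (1 - θ)) * g z.2 ^ (1 / θ * (2 * θ - 1))) *
          (k z ^ (σ * (1 - θ)) * k z ^ (σ * (1 - θ))) := by ring
      _ = _ := by rw [hc, hc, hd]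
  rw [lintegral_congr hpt] at hol
  refine hol.trans ?_
  have i1 : ∫⁻ z, f z.1 ^ (1 / θ) * k z ^ σ ∂(ν.prod ν) ≤ A * ∫⁻ x, f x ^ (1 / θ) ∂ν := by
    have hm : AEMeasurable (fun z : α × α => f z.1 ^ (1 / θ) * k z ^ σ) (ν.prod ν) :=
      hfm.mul hkm.aemeasurable
    rw [lintegral_prod _ hm, ← lintegral_const_mul'' _ (hf.pow_const _)]
    refine lintegral_mono_ae ?_
    filter_upwards [hA₁] with x hx
    rw [lintegral_const_mul _ (by fun_prop), mul_comm]
    gcongr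
  have i2 : ∫⁻ z, g z.2 ^ (1 / θ) * k z ^ σ ∂(ν.prod ν) ≤ A * ∫⁻ x, g x ^ (1 / θ) ∂ν := by
    have hm : AEMeasurable (fun z : α × α => g z.2 ^ (1 / θ) * k z ^ σ) (ν.prod ν) :=
      hgm.mul hkm.aemeasurable
    rw [lintegral_prod_symm _ hm,
      ← lintegral_const_mul'' _ (hg.pow_const _)]
    refine lintegral_mono_ae ?_
    filter_upwards [hA₂] with x hx
    rw [lintegral_const_mul _ (by fun_prop), mul_comm]
    gcongr
  rw [lintegral_prod_mul (hf.pow_const _) (hg.pow_const _)]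
  set If := ∫⁻ x, f x ^ (1 / θ) ∂ν
  set Ig := ∫⁻ x, g x ^ (1 / θ) ∂ν
  have h2 : (0 : ℝ) ≤ 2 * θ - 1 := by linarith
  calc _ ≤ (A * If) ^ (1 - θ) * (A * Ig) ^ (1 - θ) * (If * Ig) ^ (2 * θ - 1) := by gcongr
    _ = (A ^ (1 - θ) * A ^ (1 - θ)) * (If ^ (1 - θ) * If ^ (2 * θ - 1)) *
        (Ig ^ (1 - θ) * Ig ^ (2 * θ - 1)) := by
      rw [ENNReal.mul_rpow_of_nonneg _ _ h1θ.le, ENNReal.mul_rpow_of_nonneg _ _ h1θ.le,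
        ENNReal.mul_rpow_of_nonneg _ _ h2]
      ring
    _ = _ := by
      rw [← ENNReal.rpow_add_of_nonneg _ _ h1θ.le h1θ.le, ← ENNReal.rpow_add_of_nonneg _ _ h1θ.le h2,
        ← ENNReal.rpow_add_of_nonneg _ _ h1θ.le h2]
      ring_nf

variable {N : ℕ} {s : ℝ} {Ω : Set (EuclideanSpace ℝ (Fin N))}

/-- If Ω lies in a ball of radius R, then all the translates x - Ω with x in Ω lie in one ball of
radius 2R, on which |z|^(-a) is integrable; its integral is a uniform bound. -/
lemma exists_lintegral_norm_sub_rpow_neg_le (hN : 1 ≤ N) (hΩb : Bornology.IsBounded Ω) {a : ℝ}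
    (ha : a < N) : ∃ A : ℝ≥0∞, A ≠ ∞ ∧ ∀ x ∈ Ω, ∫⁻ y in Ω, ENNReal.ofReal (‖x - y‖ ^ (-a)) ≤ A := by
  obtain ⟨R, hR⟩ := hΩb.subset_ball 0
  let h : EuclideanSpace ℝ (Fin N) → ℝ≥0∞ :=
    (Metric.ball 0 (R + R)).indicator fun z => ENNReal.ofReal (‖z‖ ^ (-a))
  refine ⟨∫⁻ z, h z, ?_, fun x hx => ?_⟩
  · rw [lintegral_indicator Metric.isOpen_ball.measurableSet]
    exact (integrableOn_ball_norm_rpow_neg hN ha (R + R)).lintegral_lt_top.ne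
  · rw [← lintegral_sub_left_eq_self h x]
    refine le_trans (lintegral_mono_ae ?_) (setLIntegral_le_lintegral Ω fun y => h (x - y))
    refine ae_restrict_of_ae_restrict_of_subset hR ?_
    filter_upwards [ae_restrict_mem Metric.isOpen_ball.measurableSet] with y hy
    have hxy : x - y ∈ Metric.ball (0 : EuclideanSpace ℝ (Fin N)) (R + R) := by
      have hx' := hR hx
      rw [mem_ball_zero_iff] at hx' hy ⊢
      exact (norm_sub_le _ _).trans_lt (by linarith)
    simp only [h, Set.indicator_of_mem hxy, le_refl]

/-- The integrand of the Choquard energy. -/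
def choquardIntegrand (μ p q : ℝ) (u v : EuclideanSpace ℝ (Fin N) → ℝ)
    (z : EuclideanSpace ℝ (Fin N) × EuclideanSpace ℝ (Fin N)) : ℝ :=
  |u z.1| ^ p * (|v z.2| ^ q / ‖z.1 - z.2‖ ^ μ)

lemma choquardIntegrand_nonneg (μ p q : ℝ) (u v : EuclideanSpace ℝ (Fin N) → ℝ)
    (z : EuclideanSpace ℝ (Fin N) × EuclideanSpace ℝ (Fin N)) :
    0 ≤ choquardIntegrand μ p q u v z := by
  unfold choquardIntegrand
  positivity

lemma aemeasurable_choquardIntegrand {μ p q : ℝ} {u v : EuclideanSpace ℝ (Fin N) → ℝ}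
    {ν₁ ν₂ : Measure (EuclideanSpace ℝ (Fin N))} [SFinite ν₁] [SFinite ν₂]
    (hu : AEMeasurable u ν₁) (hv : AEMeasurable v ν₂) :
    AEMeasurable (choquardIntegrand μ p q u v) (ν₁.prod ν₂) := by
  have h1 : AEMeasurable (fun z : EuclideanSpace ℝ (Fin N) × EuclideanSpace ℝ (Fin N) => u z.1)
    (ν₁.prod ν₂) := hu.comp_quasiMeasurePreserving Measure.quasiMeasurePreserving_fst
  have h2 : AEMeasurable (fun z : EuclideanSpace ℝ (Fin N) × EuclideanSpace ℝ (Fin N) => v z.2)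
    (ν₁.prod ν₂) := hv.comp_quasiMeasurePreserving Measure.quasiMeasurePreserving_snd
  have h3 : Measurable (fun z : EuclideanSpace ℝ (Fin N) × EuclideanSpace ℝ (Fin N) =>
    ‖z.1 - z.2‖ ^ μ) := by fun_prop
  exact ((h1.norm.pow_const p).mul ((h2.norm.pow_const q).div h3.aemeasurable))

/-- The Choquard energy is controlled by the seminorms at subcritical exponents. -/
theorem exists_lintegral_choquardIntegrand_le (hs0 : 0 < s) (hN : 2 * s < (N : ℝ))
    (hΩ : MeasurableSet Ω) (hΩb : Bornology.IsBounded Ω) {μ p q : ℝ} (hμ0 : 0 < μ) (hμN : μ < N)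
    (hp0 : 0 < p) (hp : p < critExp N s μ) (hq0 : 0 < q) (hq : q < critExp N s μ) :
    ∃ C : ℝ, 0 ≤ C ∧ ∀ u v : EuclideanSpace ℝ (Fin N) → ℝ, MemX s Ω u → MemX s Ω v →
      ∫⁻ z, ENNReal.ofReal (choquardIntegrand μ p q u v z)
        ∂((volume.restrict Ω).prod (volume.restrict Ω)) ≤
        ENNReal.ofReal (C * √(innerX s u u) ^ p * √(innerX s v v) ^ q) := by
  have hN0 : (0 : ℝ) < N := by linarith
  have hN1 : 1 ≤ N := by exact_mod_cast hN0
  have hN2 : (0 : ℝ) < N - 2 * s := by linarith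
  have hS := two_lt_sobExp hs0 hN
  have hcrit : critExp N s μ = sobExp N s * (1 - μ / (2 * N)) := by
    rw [critExp, sobExp]
    field_simp
  -- The lower bounds put p/θ and q/θ within the Sobolev range and make the Hölder weight 2θ-1
  -- positive. The upper bound makes μ/(2-2θ) < N, so that the kernel power is locally integrable.
  -- Strict subcriticality leaves room between them.
  obtain ⟨θ, hθl, hθr⟩ : ∃ θ, max (max p q / sobExp N s) (1 / 2) < θ ∧ θ < 1 - μ / (2 * N) := by
    refine exists_between (max_lt ?_ ?_)
    · rw [div_lt_iff₀ (by linarith), mul_comm, ← hcrit]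
      exact max_lt hp hq
    · have : μ / (2 * N) < 1 / 2 := by
        rw [div_lt_div_iff₀ (by linarith) (by norm_num)]
        linarith
      linarith
  have hθ2 : 1 / 2 < θ := (le_max_right _ _).trans_lt hθl
  have hθ0 : 0 < θ := by linarith
  have hθ1 : θ < 1 := hθr.trans (sub_lt_self _ (by positivity))
  have hpq : max p q ≤ θ * sobExp N s := by
    rw [← div_le_iff₀ (by linarith)]
    exact ((le_max_left _ _).trans_lt hθl).le
  have h2θ : 0 < 2 - 2 * θ := by linarith
  obtain ⟨A, hAt, hA⟩ := exists_lintegral_norm_sub_rpow_neg_le hN1 hΩb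
    (a := μ * (1 / (2 - 2 * θ))) (by
      rw [mul_one_div, div_lt_iff₀ h2θ]
      have : μ / (2 * N) < 1 - θ := by linarith
      rw [div_lt_iff₀ (by positivity)] at this
      linarith)
  have hfin := hΩb.measure_lt_top (μ := volume) |>.ne
  have hpt : ∀ r, r ≤ max p q → r / θ ≤ sobExp N s := fun r hr => by
    rw [div_le_iff₀ hθ0, mul_comm]
    exact hr.trans hpq
  obtain ⟨C₁, hC₁0, hC₁⟩ := exists_lintegral_rpow_le hs0 hN hΩ hfin (r := p / θ)
    (by positivity) (hpt p (le_max_left _ _))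
  obtain ⟨C₂, hC₂0, hC₂⟩ := exists_lintegral_rpow_le hs0 hN hΩ hfin (r := q / θ)
    (by positivity) (hpt q (le_max_right _ _))
  refine ⟨(A ^ (2 - 2 * θ)).toReal * C₁ ^ θ * C₂ ^ θ, by positivity, fun u v hu hv => ?_⟩
  let k : EuclideanSpace ℝ (Fin N) × EuclideanSpace ℝ (Fin N) → ℝ≥0∞ :=
    fun z => ENNReal.ofReal (‖z.1 - z.2‖ ^ (-μ))
  have hk : Measurable k := by fun_prop
  have hkpow : ∀ x y, k (x, y) ^ (1 / (2 - 2 * θ)) =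
      ENNReal.ofReal (‖x - y‖ ^ (-(μ * (1 / (2 - 2 * θ))))) := by
    intro x y
    rw [ENNReal.ofReal_rpow_of_nonneg (by positivity) (by positivity),
      ← Real.rpow_mul (norm_nonneg _), neg_mul]
  have hfm : ∀ (w : EuclideanSpace ℝ (Fin N) → ℝ) (r : ℝ), MemX s Ω w →
      AEMeasurable (fun x => ENNReal.ofReal (|w x| ^ r)) (volume.restrict Ω) := fun w r hw =>
    (hw.memLp.1.aemeasurable.norm.pow_const r).ennreal_ofReal.restrict
  have hA₁ : ∀ᵐ x ∂(volume.restrict Ω),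
      ∫⁻ y in Ω, k (x, y) ^ (1 / (2 - 2 * θ)) ≤ A := by
    filter_upwards [ae_restrict_mem hΩ] with x hx
    simp only [hkpow]
    exact hA x hx
  have hA₂ : ∀ᵐ y ∂(volume.restrict Ω),
      ∫⁻ x in Ω, k (x, y) ^ (1 / (2 - 2 * θ)) ≤ A := by
    filter_upwards [ae_restrict_mem hΩ] with x hx
    simp only [hkpow, norm_sub_rev _ x]
    exact hA x hx
  have key := lintegral_mul_mul_kernel_le (hfm u p hu) (hfm v q hv) hk hθ2 hθ1 hA₁ hA₂
  have hbd : ∀ (w : EuclideanSpace ℝ (Fin N) → ℝ) (r C : ℝ), 0 ≤ C →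
      ∫⁻ x in Ω, ENNReal.ofReal (|w x| ^ (r / θ)) ≤
        ENNReal.ofReal (C * √(innerX s w w) ^ (r / θ)) →
      (∫⁻ x in Ω, ENNReal.ofReal (|w x| ^ r) ^ (1 / θ)) ^ θ ≤
        ENNReal.ofReal (C ^ θ * √(innerX s w w) ^ r) := by
    intro w r C hC h
    have e : ∀ x, ENNReal.ofReal (|w x| ^ r) ^ (1 / θ) = ENNReal.ofReal (|w x| ^ (r / θ)) := by
      intro x
      rw [ENNReal.ofReal_rpow_of_nonneg (by positivity) (by positivity),
        ← Real.rpow_mul (abs_nonneg _), mul_one_div]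
    simp only [e]
    refine (ENNReal.rpow_le_rpow h hθ0.le).trans (le_of_eq ?_)
    rw [ENNReal.ofReal_rpow_of_nonneg (by positivity) hθ0.le,
      Real.mul_rpow hC (by positivity), ← Real.rpow_mul (Real.sqrt_nonneg _),
      div_mul_cancel₀ _ hθ0.ne']
  refine le_trans (le_of_eq (lintegral_congr fun z => ?_)) (key.trans ?_)
  · rw [choquardIntegrand, ENNReal.ofReal_mul (by positivity), div_eq_mul_inv,
      ENNReal.ofReal_mul (by positivity), ← Real.rpow_neg (norm_nonneg _), mul_assoc]
  · refine (mul_le_mul' (mul_le_mul' le_rfl (hbd u p C₁ hC₁0 (hC₁ u hu)))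
      (hbd v q C₂ hC₂0 (hC₂ v hv))).trans (le_of_eq ?_)
    have hA' := ENNReal.ofReal_toReal (ENNReal.rpow_ne_top_of_nonneg h2θ.le hAt)
    set a := (A ^ (2 - 2 * θ)).toReal
    rw [← hA', ← ENNReal.ofReal_mul (by positivity), ← ENNReal.ofReal_mul (by positivity)]
    congr 1
    ring

end FracChoquard

end

/-! ### Poincaré inequalities and the compact embedding in L². -/

noncomputable section

namespace FracChoquard

variable {N : ℕ} {s : ℝ} {Ω : Set (EuclideanSpace ℝ (Fin N))} {u : EuclideanSpace ℝ (Fin N) → ℝ}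

/-- The Poincaré inequality in `X(Ω)`. -/
theorem exists_integral_sq_le (hs0 : 0 < s) (hN : 2 * s < (N : ℝ)) (hΩ : MeasurableSet Ω)
    (hΩf : volume Ω ≠ ∞) : ∃ C : ℝ, 0 ≤ C ∧ ∀ u : EuclideanSpace ℝ (Fin N) → ℝ, MemX s Ω u →
      ∫ x, u x ^ 2 ≤ C * innerX s u u := by
  obtain ⟨C, hC0, hC⟩ := exists_lintegral_rpow_le hs0 hN hΩ hΩf two_pos
    (two_lt_sobExp hs0 hN).le
  refine ⟨C, hC0, fun u hu => ?_⟩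
  have h := hC u hu
  have hi : IntegrableOn (fun x => u x ^ 2) Ω volume := by
    simpa only [sq] using (hu.integrable_mul hu).integrableOn
  simp only [Real.rpow_two, sq_abs, Real.sq_sqrt (innerX_self_nonneg u)] at h
  rw [← ofReal_integral_eq_lintegral_ofReal hi (.of_forall fun x => sq_nonneg _),
    ENNReal.ofReal_le_ofReal_iff (mul_nonneg hC0 (innerX_self_nonneg u))] at h
  rwa [setIntegral_eq_integral_of_ae_compl_eq_zero] at h
  filter_upwards [hu.ae_eq_zero] with x hx hxΩ
  simp [hx hxΩ]

/-- The half-open cube of side `1 / n` with index `ν` in a partition of `ℝ^N`. -/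
def cube (n : ℕ) (ν : Fin N → ℤ) : Set (EuclideanSpace ℝ (Fin N)) :=
  {x | BoxIntegral.unitPartition.index n (WithLp.ofLp x) = ν}

lemma cube_eq_preimage (n : ℕ) [NeZero n] (ν : Fin N → ℤ) :
    cube n ν = WithLp.ofLp ⁻¹' (BoxIntegral.unitPartition.box n ν : Set (Fin N → ℝ)) := by
  ext x
  change _ ↔ WithLp.ofLp x ∈ (BoxIntegral.unitPartition.box n ν : Set (Fin N → ℝ))
  rw [BoxIntegral.Box.mem_coe, BoxIntegral.unitPartition.mem_box_iff_index]
  rfl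

lemma measurableSet_cube (n : ℕ) [NeZero n] (ν : Fin N → ℤ) : MeasurableSet (cube n ν) := by
  rw [cube_eq_preimage]
  exact (PiLp.volume_preserving_ofLp (Fin N)).measurable
    (BoxIntegral.unitPartition.box n ν).measurableSet_coe

lemma volume_cube (n : ℕ) [NeZero n] (ν : Fin N → ℤ) : volume (cube n ν) = 1 / (n : ℝ≥0∞) ^ N := by
  rw [cube_eq_preimage, (PiLp.volume_preserving_ofLp (Fin N)).measure_preimage
    (BoxIntegral.unitPartition.box n ν).measurableSet_coe.nullMeasurableSet,
    BoxIntegral.unitPartition.volume_box, Fintype.card_fin]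

lemma volume_cube_ne_top (n : ℕ) [NeZero n] (ν : Fin N → ℤ) : volume (cube n ν) ≠ ∞ := by
  rw [volume_cube]
  simp [NeZero.ne n]

lemma measureReal_cube (n : ℕ) [NeZero n] (ν : Fin N → ℤ) :
    volume.real (cube n ν) = 1 / (n : ℝ) ^ N := by
  rw [measureReal_def, volume_cube]
  simp

lemma pairwise_disjoint_cube (n : ℕ) :
    Pairwise (Function.onFun Disjoint (cube (N := N) n)) := by
  intro ν ν' h
  rw [Function.onFun, Set.disjoint_left]
  intro x hx hx'
  exact h (hx.symm.trans hx')

lemma norm_sub_le_of_mem_cube {n : ℕ} [NeZero n] {ν : Fin N → ℤ} {x y : EuclideanSpace ℝ (Fin N)}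
    (hx : x ∈ cube n ν) (hy : y ∈ cube n ν) : ‖x - y‖ ≤ √N / n := by
  rw [cube_eq_preimage, Set.mem_preimage] at hx hy
  have h : ∀ i, (x i - y i) ^ 2 ≤ (1 / (n : ℝ)) ^ 2 := by
    intro i
    have hx' := BoxIntegral.unitPartition.mem_box_iff.1 hx i
    have hy' := BoxIntegral.unitPartition.mem_box_iff.1 hy i
    have : (0 : ℝ) < n := Nat.cast_pos.2 (NeZero.pos n)
    rw [add_div] at hx' hy'
    exact sq_le_sq' (by linarith [hx'.1, hx'.2, hy'.1, hy'.2])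
      (by linarith [hx'.1, hx'.2, hy'.1, hy'.2])
  rw [EuclideanSpace.norm_eq]
  calc √(∑ i, ‖(x - y) i‖ ^ 2) ≤ √(∑ _i : Fin N, (1 / (n : ℝ)) ^ 2) := by
        refine Real.sqrt_le_sqrt (Finset.sum_le_sum fun i _ => ?_)
        simpa using h i
    _ = √N / n := ?_
  rw [Finset.sum_const, Finset.card_univ, Fintype.card_fin, nsmul_eq_mul,
    Real.sqrt_mul (Nat.cast_nonneg N), Real.sqrt_sq (by positivity), mul_one_div]

lemma exists_finset_cover_cube (hΩb : Bornology.IsBounded Ω) (n : ℕ) :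
    ∃ S : Finset (Fin N → ℤ), Ω ⊆ ⋃ ν ∈ S, cube n ν := by
  obtain ⟨R, hR⟩ := hΩb.subset_closedBall 0
  -- The index of x has coordinates ⌈n xᵢ⌉ - 1, whence the shift by one at both ends.
  refine ⟨Fintype.piFinset fun _ => Finset.Icc (⌈-(n * R)⌉ - 1) (⌈n * R⌉ - 1), fun x hx => ?_⟩
  simp only [Set.mem_iUnion]
  refine ⟨BoxIntegral.unitPartition.index n (WithLp.ofLp x), ?_, rfl⟩
  rw [Fintype.mem_piFinset]
  intro i
  have hi : |x i| ≤ R := by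
    have h1 := EuclideanSpace.norm_eq x
    have h2 : ‖x‖ ≤ R := by simpa using hR hx
    exact (PiLp.norm_apply_le x i).trans h2
  have hn : (0 : ℝ) ≤ n := Nat.cast_nonneg n
  rw [abs_le] at hi
  rw [BoxIntegral.unitPartition.index_apply, Finset.mem_Icc]
  constructor
  · refine sub_le_sub_right (Int.ceil_le_ceil ?_) 1
    rw [← mul_neg]
    exact mul_le_mul_of_nonneg_left hi.1 hn
  · exact sub_le_sub_right (Int.ceil_le_ceil (mul_le_mul_of_nonneg_left hi.2 hn)) 1

/-- The fractional Poincaré–Wirtinger inequality on a cube. -/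
lemma measureReal_mul_integral_sq_le (hs0 : 0 < s) (n : ℕ) [NeZero n] (ν : Fin N → ℤ)
    (hu : MemX s Ω u) :
    volume.real (cube n ν) * ∫ x in cube n ν, u x ^ 2 ≤ (∫ x in cube n ν, u x) ^ 2 +
      (√N / n) ^ ((N : ℝ) + 2 * s) / 2 * ∫ z in cube n ν ×ˢ cube n ν, diffQuot s u z ^ 2 := by
  set Q := cube (N := N) n ν with hQ
  have hQm : MeasurableSet Q := measurableSet_cube n ν
  have hQf : volume Q ≠ ∞ := volume_cube_ne_top n ν
  have : IsFiniteMeasure (volume.restrict Q) := ⟨by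
    rw [Measure.restrict_apply_univ]
    exact hQf.lt_top⟩
  have hu1 : Integrable u (volume.restrict Q) := (hu.memLp.restrict Q).integrable (by norm_num)
  have hu2 : Integrable (fun x => u x ^ 2) (volume.restrict Q) := (hu.memLp.restrict Q).integrable_sq
  have hprod : (volume : Measure (EuclideanSpace ℝ (Fin N) × EuclideanSpace ℝ (Fin N))).restrict
      (Q ×ˢ Q) = (volume.restrict Q).prod (volume.restrict Q) := by
    rw [Measure.volume_eq_prod, Measure.prod_restrict]
  have i1 : Integrable (fun z : EuclideanSpace ℝ (Fin N) × EuclideanSpace ℝ (Fin N) => u z.1 ^ 2)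
      ((volume.restrict Q).prod (volume.restrict Q)) := hu2.comp_fst _
  have i2 : Integrable (fun z : EuclideanSpace ℝ (Fin N) × EuclideanSpace ℝ (Fin N) => u z.2 ^ 2)
      ((volume.restrict Q).prod (volume.restrict Q)) := hu2.comp_snd _
  have i12 : Integrable (fun z : EuclideanSpace ℝ (Fin N) × EuclideanSpace ℝ (Fin N) =>
      u z.1 ^ 2 + u z.2 ^ 2) ((volume.restrict Q).prod (volume.restrict Q)) := i1.add i2
  have i3 : Integrable (fun z : EuclideanSpace ℝ (Fin N) × EuclideanSpace ℝ (Fin N) =>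
      u z.1 * u z.2) ((volume.restrict Q).prod (volume.restrict Q)) := hu1.mul_prod hu1
  -- Expanding the square isolates |Q| ∫ u² - (∫ u)²; the kernel is then inserted using the diameter
  -- of the cube.
  have hid : ∫ z in Q ×ˢ Q, (u z.1 - u z.2) ^ 2 =
      2 * (volume.real Q * ∫ x in Q, u x ^ 2) - 2 * (∫ x in Q, u x) ^ 2 := by
    have e : ∀ z : EuclideanSpace ℝ (Fin N) × EuclideanSpace ℝ (Fin N), (u z.1 - u z.2) ^ 2 =
        u z.1 ^ 2 + u z.2 ^ 2 - 2 * (u z.1 * u z.2) := fun z => by ring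
    simp only [e]
    rw [hprod, integral_sub i12 (i3.const_mul 2), integral_add i1 i2,
      integral_const_mul, integral_prod_mul, integral_fun_fst (fun x => u x ^ 2),
      integral_fun_snd (fun x => u x ^ 2)]
    simp only [measureReal_restrict_apply_univ, smul_eq_mul]
    ring
  have hle : ∫ z in Q ×ˢ Q, (u z.1 - u z.2) ^ 2 ≤
      (√N / n) ^ ((N : ℝ) + 2 * s) * ∫ z in Q ×ˢ Q, diffQuot s u z ^ 2 := by
    rw [← integral_const_mul]
    refine integral_mono_of_nonneg (.of_forall fun z => sq_nonneg _)
      ((hu.memLp_diffQuot.integrable_sq.integrableOn).const_mul _) ?_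
    filter_upwards [ae_restrict_mem (hQm.prod hQm)] with z hz
    rw [sq (diffQuot s u z), diffQuot_mul, ← sq]
    rcases eq_or_ne z.1 z.2 with h | h
    · simp [h]
    · have hp : 0 < ‖z.1 - z.2‖ := norm_pos_iff.2 (sub_ne_zero.2 h)
      rw [mul_div_assoc', le_div_iff₀ (by positivity), mul_comm]
      gcongr
      exact norm_sub_le_of_mem_cube hz.1 hz.2
  linarith

/-- Summing the cube inequality, the squares Q × Q are disjoint, so their Gagliardo energies add up
to at most the whole. The factor n^N n^(-N-2s) = n^(-2s) tends to 0, so up to a small error the L²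
norm is seen by finitely many cube integrals. -/
lemma integral_sq_le_sum_cube (hs0 : 0 < s) (n : ℕ) [NeZero n] {S : Finset (Fin N → ℤ)}
    (hS : Ω ⊆ ⋃ ν ∈ S, cube n ν) (hu : MemX s Ω u) :
    ∫ x, u x ^ 2 ≤ (n : ℝ) ^ N * ∑ ν ∈ S, (∫ x in cube n ν, u x) ^ 2 +
      √N ^ ((N : ℝ) + 2 * s) / 2 * (n : ℝ) ^ (-(2 * s)) * innerX s u u := by
  have hn : (0 : ℝ) < n := Nat.cast_pos.2 (NeZero.pos n)
  have hu2 : Integrable (fun x => u x ^ 2) volume := hu.memLp.integrable_sq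
  have hsum : ∫ x, u x ^ 2 = ∑ ν ∈ S, ∫ x in cube n ν, u x ^ 2 := by
    rw [← integral_biUnion_finset S (fun ν _ => measurableSet_cube n ν)
      (fun ν _ ν' _ h => pairwise_disjoint_cube n h) (fun ν _ => hu2.integrableOn),
      setIntegral_eq_integral_of_ae_compl_eq_zero]
    filter_upwards [hu.ae_eq_zero] with x hx hxS
    rw [hx fun h => hxS (hS h), zero_pow two_ne_zero]
  have hD : ∑ ν ∈ S, ∫ z in cube n ν ×ˢ cube n ν, diffQuot s u z ^ 2 ≤ innerX s u u := by
    have hi := hu.memLp_diffQuot.integrable_sq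
    rw [← integral_biUnion_finset S
      (fun ν _ => (measurableSet_cube n ν).prod (measurableSet_cube n ν))
      (fun ν _ ν' _ h => Set.disjoint_prod.2 (.inl (pairwise_disjoint_cube n h)))
      (fun ν _ => hi.integrableOn), innerX_eq]
    simp only [← sq]
    exact setIntegral_le_integral hi (.of_forall fun z => sq_nonneg _)
  have h1 : ∀ ν ∈ S, ∫ x in cube n ν, u x ^ 2 ≤ (n : ℝ) ^ N * (∫ x in cube n ν, u x) ^ 2 +
      (n : ℝ) ^ N * ((√N / n) ^ ((N : ℝ) + 2 * s) / 2) *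
        ∫ z in cube n ν ×ˢ cube n ν, diffQuot s u z ^ 2 := by
    intro ν _
    have h := measureReal_mul_integral_sq_le hs0 n ν hu
    rw [measureReal_cube, one_div, inv_mul_le_iff₀ (by positivity)] at h
    linarith
  have hc : (n : ℝ) ^ N * ((√N / n) ^ ((N : ℝ) + 2 * s) / 2) =
      √N ^ ((N : ℝ) + 2 * s) / 2 * (n : ℝ) ^ (-(2 * s)) := by
    rw [Real.div_rpow (Real.sqrt_nonneg _) hn.le, Real.rpow_neg hn.le,
      Real.rpow_add hn, Real.rpow_natCast]
    field_simp
  rw [hsum]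
  refine (Finset.sum_le_sum h1).trans ?_
  rw [Finset.sum_add_distrib, ← Finset.mul_sum, ← Finset.mul_sum, hc]
  gcongr

lemma dist_toLp_sq {v : EuclideanSpace ℝ (Fin N) → ℝ} (hu : MemLp u 2 volume)
    (hv : MemLp v 2 volume) : dist (hu.toLp u) (hv.toLp v) ^ 2 = ∫ x, (u x - v x) ^ 2 := by
  rw [dist_eq_norm, ← MemLp.toLp_sub, ← real_inner_self_eq_norm_sq, L2.inner_def]
  refine integral_congr_ae ?_
  filter_upwards [(hu.sub hv).coeFn_toLp] with x hx
  rw [hx]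
  simp [sq]

/-- Bounded subsets of `X(Ω)` are totally bounded in `L²`. -/
theorem totallyBounded_range_toLp (hs0 : 0 < s) (hN : 2 * s < (N : ℝ)) (hΩ : MeasurableSet Ω)
    (hΩb : Bornology.IsBounded Ω) {u : ℕ → EuclideanSpace ℝ (Fin N) → ℝ}
    (hu : ∀ k, MemX s Ω (u k)) {R : ℝ} (hR : ∀ k, innerX s (u k) (u k) ≤ R) :
    TotallyBounded (Set.range fun k => (hu k).memLp.toLp (u k)) := by
  have hR0 : 0 ≤ R := (innerX_self_nonneg _).trans (hR 0)
  obtain ⟨P, hP0, hP⟩ := exists_integral_sq_le hs0 hN hΩ hΩb.measure_lt_top.ne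
  refine Metric.totallyBounded_of_finite_discretization fun ε hε => ?_
  -- The mesh is so fine that the oscillation term is below ε²/2 for differences of two members,
  -- whose energy is at most 4R.
  obtain ⟨n, hn0, hn⟩ : ∃ n : ℕ, n ≠ 0 ∧
      √N ^ ((N : ℝ) + 2 * s) / 2 * (n : ℝ) ^ (-(2 * s)) * (4 * R) < ε ^ 2 / 2 := by
    have h1 : Tendsto (fun n : ℕ => √N ^ ((N : ℝ) + 2 * s) / 2 * (n : ℝ) ^ (-(2 * s)) * (4 * R))
        atTop (𝓝 (√N ^ ((N : ℝ) + 2 * s) / 2 * 0 * (4 * R))) :=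
      (((tendsto_rpow_neg_atTop (by linarith)).comp tendsto_natCast_atTop_atTop).const_mul
        _).mul_const _
    rw [mul_zero, zero_mul] at h1
    obtain ⟨n, h2, h3⟩ := ((h1.eventually_lt_const (by positivity : 0 < ε ^ 2 / 2)).and
      (eventually_ne_atTop 0)).exists
    exact ⟨n, h3, h2⟩
  have : NeZero n := ⟨hn0⟩
  obtain ⟨S, hS⟩ := exists_finset_cover_cube hΩb n
  -- The precision 1/K to which cube integrals are recorded leaves the other ε²/2.
  obtain ⟨K, hK1, hK⟩ : ∃ K : ℝ, 0 < K ∧ (n : ℝ) ^ N * (S.card * (1 / K) ^ 2) < ε ^ 2 / 2 := by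
    have h1 : Tendsto (fun K : ℝ => (n : ℝ) ^ N * (S.card * (1 / K) ^ 2)) atTop
        (𝓝 ((n : ℝ) ^ N * (S.card * 0 ^ 2))) := by
      simp only [one_div]
      exact ((tendsto_inv_atTop_zero.pow 2).const_mul _).const_mul _
    rw [zero_pow two_ne_zero, mul_zero, mul_zero] at h1
    obtain ⟨K, h2, h3⟩ := ((h1.eventually_lt_const (by positivity : 0 < ε ^ 2 / 2)).and
      (eventually_gt_atTop 0)).exists
    exact ⟨K, h3, h2⟩
  set B : ℝ := 1 / (n : ℝ) ^ N + P * R with hB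
  have hbound : ∀ k ν, |∫ x in cube n ν, u k x| ≤ B := by
    intro k ν
    have hc : Integrable (fun _ => (1 : ℝ)) (volume.restrict (cube n ν)) :=
      integrableOn_const (volume_cube_ne_top n ν)
    have hu2 : Integrable (fun x => u k x ^ 2) (volume.restrict (cube n ν)) :=
      (hu k).memLp.integrable_sq.integrableOn
    have hi : Integrable (fun x => 1 + u k x ^ 2) (volume.restrict (cube n ν)) := hc.add hu2
    have h1 : ∫ x in cube n ν, u k x ^ 2 ≤ P * R :=
      (setIntegral_le_integral (hu k).memLp.integrable_sq (.of_forall fun x => sq_nonneg _)).trans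
        ((hP _ (hu k)).trans (mul_le_mul_of_nonneg_left (hR k) hP0))
    calc |∫ x in cube n ν, u k x| ≤ ∫ x in cube n ν, (1 + u k x ^ 2) := by
          rw [← Real.norm_eq_abs]
          refine norm_integral_le_of_norm_le hi (.of_forall fun x => ?_)
          rw [Real.norm_eq_abs]
          nlinarith [sq_nonneg (|u k x| - 1), sq_abs (u k x)]
      _ = 1 / (n : ℝ) ^ N + ∫ x in cube n ν, u k x ^ 2 := by
          rw [integral_add hc hu2, setIntegral_const, measureReal_cube, smul_eq_mul, mul_one]
      _ ≤ B := by rw [hB]; gcongr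
  let κ : Set.range (fun k => (hu k).memLp.toLp (u k)) → ℕ := fun f => f.2.choose
  have hκ : ∀ f, (hu (κ f)).memLp.toLp (u (κ f)) = f.1 := fun f => f.2.choose_spec
  -- A function is encoded by the integer parts of K times its cube integrals; the bound `B` makes
  -- the set of codes finite.
  refine ⟨S → Set.Icc ⌊-(K * B)⌋ ⌊K * B⌋, inferInstance,
    fun f ν => ⟨⌊K * ∫ x in cube n ν.1, u (κ f) x⌋, ?_, ?_⟩, fun f g hfg => ?_⟩
  · have := (abs_le.1 (hbound (κ f) ν.1)).1
    refine Int.floor_le_floor ?_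
    rw [← mul_neg]
    gcongr
  · have := (abs_le.1 (hbound (κ f) ν.1)).2
    exact Int.floor_le_floor (by gcongr)
  · have hd : ∀ ν ∈ S, (∫ x in cube n ν, (u (κ f) - u (κ g)) x) ^ 2 ≤ (1 / K) ^ 2 := by
      intro ν hν
      have h1 := congrArg Subtype.val (congrFun hfg ⟨ν, hν⟩)
      have h2 := Int.abs_sub_lt_one_of_floor_eq_floor h1
      have : IsFiniteMeasure (volume.restrict (cube n ν)) := ⟨by
        rw [Measure.restrict_apply_univ]
        exact (volume_cube_ne_top n ν).lt_top⟩
      simp only [Pi.sub_apply]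
      rw [integral_sub (((hu _).memLp.restrict _).integrable (by norm_num))
        (((hu _).memLp.restrict _).integrable (by norm_num)), ← sq_abs]
      refine pow_le_pow_left₀ (abs_nonneg _) ?_ 2
      rw [← mul_sub, abs_mul, abs_of_pos hK1] at h2
      rw [le_div_iff₀ hK1, mul_comm]
      exact h2.le
    have hX := (hu (κ f)).sub (hu (κ g))
    -- Parallelogram identity, with the energy of the sum dropped.
    have hE : innerX s (u (κ f) - u (κ g)) (u (κ f) - u (κ g)) ≤ 4 * R := by
      have h1 := innerX_add_smul_self (hu (κ f)) (hu (κ g)) (-1)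
      have h2 := innerX_add_smul_self (hu (κ f)) (hu (κ g)) 1
      have h3 := innerX_self_nonneg (s := s) (u (κ f) + (1 : ℝ) • u (κ g))
      rw [neg_one_smul, ← sub_eq_add_neg] at h1
      linarith [hR (κ f), hR (κ g)]
    have hmain := integral_sq_le_sum_cube hs0 n hS hX
    rw [← hκ f, ← hκ g]
    refine lt_of_pow_lt_pow_left₀ 2 hε.le ?_
    rw [dist_toLp_sq]
    refine hmain.trans_lt ?_
    have h1 : (n : ℝ) ^ N * ∑ ν ∈ S, (∫ x in cube n ν, (u (κ f) - u (κ g)) x) ^ 2 ≤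
        (n : ℝ) ^ N * (S.card * (1 / K) ^ 2) := by
      gcongr
      rw [← nsmul_eq_mul]
      exact Finset.sum_le_card_nsmul _ _ _ hd
    have h2 : √N ^ ((N : ℝ) + 2 * s) / 2 * (n : ℝ) ^ (-(2 * s)) *
        innerX s (u (κ f) - u (κ g)) (u (κ f) - u (κ g)) ≤
        √N ^ ((N : ℝ) + 2 * s) / 2 * (n : ℝ) ^ (-(2 * s)) * (4 * R) := by
      gcongr
    linarith

/-- Both coordinate projections pull null sets back to null sets. This lets Fatou be applied to the
Gagliardo seminorms. -/
lemma tendsto_diffQuot {u : ℕ → EuclideanSpace ℝ (Fin N) → ℝ} {w : EuclideanSpace ℝ (Fin N) → ℝ}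
    (h : ∀ᵐ x, Tendsto (fun k => u k x) atTop (𝓝 (w x))) :
    ∀ᵐ z, Tendsto (fun k => diffQuot s (u k) z) atTop (𝓝 (diffQuot s w z)) := by
  have h1 : ∀ᵐ z : EuclideanSpace ℝ (Fin N) × EuclideanSpace ℝ (Fin N),
      Tendsto (fun k => u k z.1) atTop (𝓝 (w z.1)) :=
    Measure.quasiMeasurePreserving_fst.ae h
  have h2 : ∀ᵐ z : EuclideanSpace ℝ (Fin N) × EuclideanSpace ℝ (Fin N),
      Tendsto (fun k => u k z.2) atTop (𝓝 (w z.2)) :=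
    Measure.quasiMeasurePreserving_snd.ae h
  filter_upwards [h1, h2] with z h1 h2
  exact (h1.sub h2).div_const _

/-- The compact embedding of `X(Ω)` in `L²`. -/
theorem exists_subseq_tendsto (hs0 : 0 < s) (hN : 2 * s < (N : ℝ)) (hΩ : MeasurableSet Ω)
    (hΩb : Bornology.IsBounded Ω) {u : ℕ → EuclideanSpace ℝ (Fin N) → ℝ}
    (hu : ∀ k, MemX s Ω (u k)) {R : ℝ} (hR : ∀ k, innerX s (u k) (u k) ≤ R) :
    ∃ (w : EuclideanSpace ℝ (Fin N) → ℝ) (hw : MemX s Ω w) (ns : ℕ → ℕ), StrictMono ns ∧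
      Tendsto (fun k => (hu (ns k)).memLp.toLp (u (ns k))) atTop (𝓝 (hw.memLp.toLp w)) ∧
      ∀ᵐ x, Tendsto (fun k => u (ns k) x) atTop (𝓝 (w x)) := by
  have hc : IsCompact (closure (Set.range fun k => (hu k).memLp.toLp (u k))) :=
    isCompact_iff_totallyBounded_isComplete.2
      ⟨(totallyBounded_range_toLp hs0 hN hΩ hΩb hu hR).closure, isClosed_closure.isComplete⟩
  obtain ⟨g, -, ns, hns, hg⟩ := hc.tendsto_subseq fun k => subset_closure (Set.mem_range_self k)
  have hm : TendstoInMeasure volume (fun k => ((hu (ns k)).memLp.toLp (u (ns k)) :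
      EuclideanSpace ℝ (Fin N) → ℝ)) atTop g :=
    tendstoInMeasure_of_tendsto_Lp hg
  obtain ⟨ms, hms, hae⟩ := hm.exists_seq_tendsto_ae
  have hae' : ∀ᵐ x, Tendsto (fun k => u (ns (ms k)) x) atTop (𝓝 (g x)) := by
    have h1 : ∀ᵐ x, ∀ k, ((hu k).memLp.toLp (u k)) x = u k x :=
      ae_all_iff.2 fun k => (hu k).memLp.coeFn_toLp
    filter_upwards [hae, h1] with x hx h1
    simpa only [h1] using hx
  -- The L² norm of the difference quotients is lower semicontinuous under a.e. convergence, so the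
  -- limit has finite seminorm.
  have hgX : MemX s Ω g := by
    refine MemX.mk' (Lp.memLp g) ⟨aestronglyMeasurable_diffQuot (Lp.aestronglyMeasurable g), ?_⟩ ?_
    · refine (Lp.eLpNorm_le_of_ae_tendsto (u := atTop) (C := ENNReal.ofReal R ^ (1 / 2 : ℝ))
        (f := fun k => diffQuot s (u (ns (ms k))))
        (.of_forall fun k => ?_) (fun k => (hu _).memLp_diffQuot.1)
        (tendsto_diffQuot hae')).trans_lt ?_
      · rw [eLpNorm_eq_lintegral_rpow_enorm_toReal (by norm_num) (by norm_num),
          ENNReal.toReal_ofNat]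
        gcongr
        refine le_trans (le_of_eq (lintegral_congr fun z => ?_))
          ((lintegral_diffQuot_sq (hu (ns (ms k)))).le.trans (ENNReal.ofReal_le_ofReal (hR _)))
        rw [Real.enorm_eq_ofReal_abs, ENNReal.rpow_ofNat, ← ENNReal.ofReal_pow (abs_nonneg _),
          sq_abs]
      · exact ENNReal.rpow_lt_top_of_nonneg (by norm_num) ENNReal.ofReal_ne_top
    · have h0 : ∀ᵐ x, ∀ k, x ∉ Ω → u k x = 0 := ae_all_iff.2 fun k => (hu k).ae_eq_zero
      filter_upwards [hae', h0] with x hx h0 hxΩ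
      simp only [h0 _ hxΩ] at hx
      exact tendsto_nhds_unique hx tendsto_const_nhds
  refine ⟨g, hgX, ns ∘ ms, hns.comp hms, ?_, hae'⟩
  rw [show hgX.memLp.toLp g = g from Lp.toLp_coeFn g _]
  exact hg.comp hms.tendsto_atTop

end FracChoquard

end

/-! ### Coercivity, the Choquard energy, and limits of integrals. -/

noncomputable section

namespace FracChoquard

/-- The quadratic form of a symmetric `2 × 2` matrix is bounded by its largest eigenvalue. -/
lemma quadForm_le_of_isGreatest {a b c m : ℝ}
    (hm : IsGreatest {m : ℝ | Module.End.HasEigenvalue (Matrix.toLin' !![a, b; b, c]) m} m)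
    (x y : ℝ) : a * x ^ 2 + 2 * b * x * y + c * y ^ 2 ≤ m * (x ^ 2 + y ^ 2) := by
  set r := √(((a - c) / 2) ^ 2 + b ^ 2) with hr
  have hr2 : r ^ 2 = ((a - c) / 2) ^ 2 + b ^ 2 := Real.sq_sqrt (by positivity)
  have hrabs : |(a - c) / 2| ≤ r := Real.abs_le_sqrt (by nlinarith [sq_nonneg b])
  rw [abs_le] at hrabs
  -- The larger root of the characteristic polynomial. An eigenvector is (b, l-a) if b ≠ 0, a
  -- coordinate vector otherwise.
  obtain ⟨l, hl⟩ : ∃ l, l = (a + c) / 2 + r := ⟨_, rfl⟩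
  have hA : 0 ≤ l - a := by linarith [hrabs.2]
  have hB : 0 ≤ l - c := by linarith [hrabs.1]
  have hAB : (l - a) * (l - c) = b ^ 2 := by
    rw [hl]
    linear_combination hr2
  have heig : ∀ v : Fin 2 → ℝ, v ≠ 0 → a * v 0 + b * v 1 = l * v 0 →
      b * v 0 + c * v 1 = l * v 1 → l ≤ m := by
    intro v hv h0 h1
    refine hm.2 (Module.End.hasEigenvalue_of_hasEigenvector (x := v)
      ⟨Module.End.mem_eigenspace_iff.2 ?_, hv⟩)
    ext i
    fin_cases i
    · simpa [Matrix.mulVec, dotProduct, Fin.sum_univ_two] using h0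
    · simpa [Matrix.mulVec, dotProduct, Fin.sum_univ_two] using h1
  have hlm : l ≤ m := by
    by_cases hb : b = 0
    · rw [hb, zero_pow two_ne_zero, mul_eq_zero] at hAB
      rcases hAB with h | h
      · exact heig ![1, 0] (fun h => by simpa using congrFun h 0) (by simp; linarith) (by simp [hb])
      · exact heig ![0, 1] (fun h => by simpa using congrFun h 1) (by simp [hb]) (by simp; linarith)
    · exact heig ![b, l - a] (fun h => hb (by simpa using congrFun h 0)) (by simp; ring)
        (by simp; linear_combination -hAB)
  have hq : a * x ^ 2 + 2 * b * x * y + c * y ^ 2 ≤ l * (x ^ 2 + y ^ 2) := by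
    rcases hA.eq_or_lt with h | h
    · have hb : b = 0 := by
        rw [← h, zero_mul] at hAB
        exact pow_eq_zero_iff two_ne_zero |>.1 hAB.symm
      rw [hb]
      nlinarith [mul_nonneg hB (sq_nonneg y)]
    -- Completing the square: multiplied by l-a, the gap is the square of (l-a)x - by.
    · have h1 : 0 ≤ (l - a) * (l * (x ^ 2 + y ^ 2) - (a * x ^ 2 + 2 * b * x * y + c * y ^ 2)) := by
        have : (l - a) * (l * (x ^ 2 + y ^ 2) - (a * x ^ 2 + 2 * b * x * y + c * y ^ 2)) =
            ((l - a) * x - b * y) ^ 2 := by linear_combination y ^ 2 * hAB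
        rw [this]
        exact sq_nonneg _
      linarith [nonneg_of_mul_nonneg_right h1 h]
  exact hq.trans (mul_le_mul_of_nonneg_right hlm (by positivity))

variable {N : ℕ} {s : ℝ} {Ω : Set (EuclideanSpace ℝ (Fin N))} {u v : EuclideanSpace ℝ (Fin N) → ℝ}

lemma firstEigenvalue_mul_le (hu : MemX s Ω u) :
    firstEigenvalue s Ω * ∫ x, u x ^ 2 ≤ innerX s u u := by
  by_cases h : u =ᵐ[volume] 0
  · have : ∫ x, u x ^ 2 = 0 := by
      rw [integral_congr_ae (g := fun _ => 0) (by filter_upwards [h] with x hx; simp [hx])]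
      simp
    rw [this, mul_zero]
    exact innerX_self_nonneg u
  · have hpos : 0 < ∫ x, u x ^ 2 := by
      refine lt_of_le_of_ne (integral_nonneg fun x => sq_nonneg _) fun h0 => h ?_
      have h1 := (integral_eq_zero_iff_of_nonneg (fun x => sq_nonneg _) hu.memLp.integrable_sq).1
        h0.symm
      filter_upwards [h1] with x hx
      simpa using hx
    rw [← le_div_iff₀ hpos]
    refine csInf_le ⟨0, ?_⟩ ⟨u, hu, h, rfl⟩
    rintro r ⟨u, -, -, rfl⟩
    exact div_nonneg (innerX_self_nonneg u) (integral_nonneg fun x => sq_nonneg _)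

/-- The quadratic part of the energy of the system. -/
def quadEnergy (s a b c : ℝ) (u v : EuclideanSpace ℝ (Fin N) → ℝ) : ℝ :=
  innerX s u u + innerX s v v - (a * ∫ x, u x ^ 2) - (2 * b * ∫ x, u x * v x) - c * ∫ x, v x ^ 2

lemma exists_pos_mul_le_quadEnergy {a b c m : ℝ}
    (hm : IsGreatest {m : ℝ | Module.End.HasEigenvalue (Matrix.toLin' !![a, b; b, c]) m} m)
    (hlam : m < firstEigenvalue s Ω) : ∃ δ : ℝ, 0 < δ ∧
      ∀ u v : EuclideanSpace ℝ (Fin N) → ℝ, MemX s Ω u → MemX s Ω v →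
        δ * (innerX s u u + innerX s v v) ≤ quadEnergy s a b c u v := by
  have hquad : ∀ u v : EuclideanSpace ℝ (Fin N) → ℝ, MemX s Ω u → MemX s Ω v →
      (a * ∫ x, u x ^ 2) + (2 * b * ∫ x, u x * v x) + (c * ∫ x, v x ^ 2) ≤
        m * ((∫ x, u x ^ 2) + ∫ x, v x ^ 2) := by
    intro u v hu hv
    have i1 : Integrable (fun x => a * u x ^ 2) volume := hu.memLp.integrable_sq.const_mul a
    have i2 : Integrable (fun x => 2 * b * (u x * v x)) volume :=
      (hu.integrable_mul hv).const_mul (2 * b)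
    have i3 : Integrable (fun x => c * v x ^ 2) volume := hv.memLp.integrable_sq.const_mul c
    have i12 : Integrable (fun x => a * u x ^ 2 + 2 * b * (u x * v x)) volume := i1.add i2
    rw [← integral_const_mul, ← integral_const_mul, ← integral_const_mul, ← integral_add i1 i2,
      ← integral_add i12 i3, ← integral_add hu.memLp.integrable_sq hv.memLp.integrable_sq,
      ← integral_const_mul]
    refine integral_mono (i12.add i3)
      ((hu.memLp.integrable_sq.add hv.memLp.integrable_sq).const_mul m) fun x => ?_
    have := quadForm_le_of_isGreatest hm (u x) (v x)
    simpa only [mul_assoc] using this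
  -- For m ≤ 0 the zero-order part only helps, and the Rayleigh quotient, whose use requires m > 0,
  -- is not needed.
  by_cases hm0 : m ≤ 0
  · refine ⟨1, one_pos, fun u v hu hv => ?_⟩
    have h1 := hquad u v hu hv
    have h2 : 0 ≤ ∫ x, u x ^ 2 := integral_nonneg fun x => sq_nonneg _
    have h3 : 0 ≤ ∫ x, v x ^ 2 := integral_nonneg fun x => sq_nonneg _
    have h4 : m * ((∫ x, u x ^ 2) + ∫ x, v x ^ 2) ≤ 0 :=
      mul_nonpos_of_nonpos_of_nonneg hm0 (by positivity)
    rw [quadEnergy]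
    linarith
  · push Not at hm0
    have hl : 0 < firstEigenvalue s Ω := hm0.trans hlam
    refine ⟨1 - m / firstEigenvalue s Ω, by rwa [sub_pos, div_lt_one hl], fun u v hu hv => ?_⟩
    have h1 := hquad u v hu hv
    have h2 := firstEigenvalue_mul_le hu
    have h3 := firstEigenvalue_mul_le hv
    have h4 : m * ((∫ x, u x ^ 2) + ∫ x, v x ^ 2) ≤
        m / firstEigenvalue s Ω * (innerX s u u + innerX s v v) := by
      rw [div_mul_eq_mul_div, le_div_iff₀ hl, mul_assoc]
      exact mul_le_mul_of_nonneg_left (by linarith) hm0.le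
    rw [quadEnergy]
    linarith

lemma quadEnergy_smul (a b c t : ℝ) (u v : EuclideanSpace ℝ (Fin N) → ℝ) :
    quadEnergy s a b c (t • u) (t • v) = t ^ 2 * quadEnergy s a b c u v := by
  have h1 : ∀ w : EuclideanSpace ℝ (Fin N) → ℝ, ∫ x, (t • w) x ^ 2 = t ^ 2 * ∫ x, w x ^ 2 := by
    intro w
    rw [← integral_const_mul]
    simp [mul_pow]
  have h2 : ∫ x, (t • u) x * (t • v) x = t ^ 2 * ∫ x, u x * v x := by
    rw [← integral_const_mul]
    refine integral_congr_ae (.of_forall fun x => ?_)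
    simp only [Pi.smul_apply, smul_eq_mul]
    ring
  rw [quadEnergy, quadEnergy, innerX_smul_self, innerX_smul_self, h1, h1, h2]
  ring

/-- The seminorms contract under the absolute value, the squares are unchanged, and the coupling
integral can only grow; it enters with the sign of -b. -/
lemma quadEnergy_abs_le {a b c : ℝ} (hb : 0 ≤ b) (hu : MemX s Ω u) (hv : MemX s Ω v) :
    quadEnergy s a b c (fun x => |u x|) (fun x => |v x|) ≤ quadEnergy s a b c u v := by
  have h1 := innerX_abs_self_le hu
  have h2 := innerX_abs_self_le hv
  have h3 : ∫ x, u x * v x ≤ ∫ x, |u x| * |v x| :=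
    integral_mono (hu.integrable_mul hv) (hu.abs.integrable_mul hv.abs) fun x => by
      rw [← abs_mul]
      exact le_abs_self _
  have h4 : 2 * b * ∫ x, u x * v x ≤ 2 * b * ∫ x, |u x| * |v x| :=
    mul_le_mul_of_nonneg_left h3 (by positivity)
  simp only [quadEnergy, sq_abs]
  linarith

/-- The Choquard energy `∫∫ |u(x)|^p |v(y)|^q / |x - y|^μ dx dy` over `Ω × Ω`. -/
def choquardEnergy (Ω : Set (EuclideanSpace ℝ (Fin N))) (μ p q : ℝ)
    (u v : EuclideanSpace ℝ (Fin N) → ℝ) : ℝ :=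
  ∫ z, choquardIntegrand μ p q u v z ∂((volume.restrict Ω).prod (volume.restrict Ω))

lemma choquardEnergy_nonneg (Ω : Set (EuclideanSpace ℝ (Fin N))) (μ p q : ℝ)
    (u v : EuclideanSpace ℝ (Fin N) → ℝ) : 0 ≤ choquardEnergy Ω μ p q u v :=
  integral_nonneg fun _ => choquardIntegrand_nonneg _ _ _ _ _ _

lemma choquardEnergy_smul {μ p q t : ℝ} (ht : 0 < t) (u v : EuclideanSpace ℝ (Fin N) → ℝ) :
    choquardEnergy Ω μ p q (t • u) (t • v) = t ^ (p + q) * choquardEnergy Ω μ p q u v := by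
  rw [choquardEnergy, choquardEnergy, ← integral_const_mul]
  refine integral_congr_ae (.of_forall fun z => ?_)
  simp only [choquardIntegrand, Pi.smul_apply, smul_eq_mul, abs_mul, abs_of_pos ht]
  rw [Real.mul_rpow ht.le (abs_nonneg _), Real.mul_rpow ht.le (abs_nonneg _), Real.rpow_add ht]
  ring

lemma choquardEnergy_abs (μ p q : ℝ) (u v : EuclideanSpace ℝ (Fin N) → ℝ) :
    choquardEnergy Ω μ p q (fun x => |u x|) (fun x => |v x|) = choquardEnergy Ω μ p q u v := by
  simp only [choquardEnergy, choquardIntegrand, abs_abs]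

/-- The kernel is symmetric. Exchanging the variables lets every statement on the first component be
applied to the second. -/
lemma choquardEnergy_comm (μ p q : ℝ) (u v : EuclideanSpace ℝ (Fin N) → ℝ) :
    choquardEnergy Ω μ p q u v = choquardEnergy Ω μ q p v u := by
  rw [choquardEnergy, choquardEnergy, ← integral_prod_swap]
  refine integral_congr_ae (.of_forall fun z => ?_)
  simp only [choquardIntegrand, Prod.fst_swap, Prod.snd_swap, norm_sub_rev z.2 z.1]
  ring

/-- The hypotheses on the domain and on the exponents in the subcritical system. -/
structure Subcritical (s : ℝ) (Ω : Set (EuclideanSpace ℝ (Fin N))) (μ p q : ℝ) : Prop where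
  s_pos : 0 < s
  two_mul_s_lt : 2 * s < (N : ℝ)
  isOpen : IsOpen Ω
  isBounded : Bornology.IsBounded Ω
  mu_pos : 0 < μ
  mu_lt : μ < (N : ℝ)
  one_lt_p : 1 < p
  p_lt : p < critExp N s μ
  one_lt_q : 1 < q
  q_lt : q < critExp N s μ

namespace Subcritical

variable {μ p q : ℝ}

lemma symm (h : Subcritical s Ω μ p q) : Subcritical s Ω μ q p :=
  ⟨h.s_pos, h.two_mul_s_lt, h.isOpen, h.isBounded, h.mu_pos, h.mu_lt, h.one_lt_q, h.q_lt,
    h.one_lt_p, h.p_lt⟩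

lemma volume_ne_top (h : Subcritical s Ω μ p q) : volume Ω ≠ ∞ := h.isBounded.measure_lt_top.ne

lemma exists_lintegral_le (h : Subcritical s Ω μ p q) :
    ∃ C : ℝ, 0 ≤ C ∧ ∀ u v : EuclideanSpace ℝ (Fin N) → ℝ, MemX s Ω u → MemX s Ω v →
      ∫⁻ z, ENNReal.ofReal (choquardIntegrand μ p q u v z)
        ∂((volume.restrict Ω).prod (volume.restrict Ω)) ≤
        ENNReal.ofReal (C * √(innerX s u u) ^ p * √(innerX s v v) ^ q) :=
  exists_lintegral_choquardIntegrand_le h.s_pos h.two_mul_s_lt h.isOpen.measurableSet h.isBounded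
    h.mu_pos h.mu_lt (one_pos.trans h.one_lt_p) h.p_lt (one_pos.trans h.one_lt_q) h.q_lt

lemma integrable (h : Subcritical s Ω μ p q) (hu : MemX s Ω u) (hv : MemX s Ω v) :
    Integrable (choquardIntegrand μ p q u v) ((volume.restrict Ω).prod (volume.restrict Ω)) := by
  obtain ⟨C, -, hC⟩ := h.exists_lintegral_le
  refine ⟨(aemeasurable_choquardIntegrand hu.memLp.1.aemeasurable.restrict
    hv.memLp.1.aemeasurable.restrict).aestronglyMeasurable, ?_⟩
  rw [hasFiniteIntegral_iff_ofReal (.of_forall fun z => choquardIntegrand_nonneg _ _ _ _ _ _)]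
  exact (hC u v hu hv).trans_lt ENNReal.ofReal_lt_top

lemma exists_choquardEnergy_le (h : Subcritical s Ω μ p q) :
    ∃ C : ℝ, 0 ≤ C ∧ ∀ u v : EuclideanSpace ℝ (Fin N) → ℝ, MemX s Ω u → MemX s Ω v →
      choquardEnergy Ω μ p q u v ≤ C * √(innerX s u u) ^ p * √(innerX s v v) ^ q := by
  obtain ⟨C, hC0, hC⟩ := h.exists_lintegral_le
  refine ⟨C, hC0, fun u v hu hv => ?_⟩
  have h1 := hC u v hu hv
  rwa [← ofReal_integral_eq_lintegral_ofReal (h.integrable hu hv)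
    (.of_forall fun z => choquardIntegrand_nonneg _ _ _ _ _ _),
    ENNReal.ofReal_le_ofReal_iff (by positivity)] at h1

/-- There is some room in the exponents. -/
lemma exists_scaled (h : Subcritical s Ω μ p q) :
    ∃ τ : ℝ, 0 < τ ∧ Subcritical s Ω (μ * (1 + τ)) (p * (1 + τ)) (q * (1 + τ)) := by
  have hlim : ∀ a : ℝ, Tendsto (fun τ : ℝ => a * (1 + τ)) (𝓝[>] 0) (𝓝 a) := fun a => by
    have : ContinuousAt (fun τ : ℝ => a * (1 + τ)) 0 := by fun_prop
    simpa using this.tendsto.mono_left nhdsWithin_le_nhds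
  -- Raising the integrand to a power also changes μ, hence the critical exponent; it does so
  -- continuously, so the strict inequalities survive for small τ.
  have hcrit : Tendsto (fun τ : ℝ => critExp N s (μ * (1 + τ))) (𝓝[>] 0) (𝓝 (critExp N s μ)) :=
    ((hlim μ).const_sub (2 * (N : ℝ))).div_const _
  obtain ⟨τ, h1, h2, h3, h4⟩ := (((hlim μ).eventually_lt_const h.mu_lt).and
    (((hlim p).eventually_lt hcrit h.p_lt).and
      (((hlim q).eventually_lt hcrit h.q_lt).and self_mem_nhdsWithin))).exists
  have h4 : 0 < τ := h4
  have hmul : ∀ a : ℝ, 1 < a → 1 < a * (1 + τ) := fun a ha => by nlinarith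
  exact ⟨τ, h4, h.s_pos, h.two_mul_s_lt, h.isOpen, h.isBounded, mul_pos h.mu_pos (by linarith), h1,
    hmul p h.one_lt_p, h2, hmul q h.one_lt_q, h3⟩

end Subcritical

/-- Higher integrability of the integrand thus reduces to the same energy with scaled parameters. -/
lemma choquardIntegrand_rpow (μ p q r : ℝ) (u v : EuclideanSpace ℝ (Fin N) → ℝ)
    (z : EuclideanSpace ℝ (Fin N) × EuclideanSpace ℝ (Fin N)) :
    choquardIntegrand μ p q u v z ^ r = choquardIntegrand (μ * r) (p * r) (q * r) u v z := by
  rw [choquardIntegrand, choquardIntegrand, Real.mul_rpow (by positivity) (by positivity),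
    Real.div_rpow (by positivity) (by positivity), ← Real.rpow_mul (abs_nonneg _),
    ← Real.rpow_mul (abs_nonneg _), ← Real.rpow_mul (norm_nonneg _)]

section Convergence

variable {α : Type*} [MeasurableSpace α] {ν : Measure α} {f : ℕ → α → ℝ} {g : α → ℝ}

/-- Fatou's lemma for Bochner integrals. -/
lemma integral_le_of_ae_tendsto (hf0 : ∀ n x, 0 ≤ f n x) (hf : ∀ n, Integrable (f n) ν)
    (hg : Integrable g ν) (hlim : ∀ᵐ x ∂ν, Tendsto (fun n => f n x) atTop (𝓝 (g x)))
    {c : ℕ → ℝ} {l : ℝ} (hc : ∀ n, ∫ x, f n x ∂ν ≤ c n) (hl : Tendsto c atTop (𝓝 l)) :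
    ∫ x, g x ∂ν ≤ l := by
  have hl0 : 0 ≤ l := ge_of_tendsto' hl fun n => (integral_nonneg (hf0 n)).trans (hc n)
  have hg0 : 0 ≤ᵐ[ν] g := by
    filter_upwards [hlim] with x hx
    exact ge_of_tendsto' hx fun n => hf0 n x
  rw [← ENNReal.ofReal_le_ofReal_iff hl0, ofReal_integral_eq_lintegral_ofReal hg hg0]
  calc ∫⁻ x, ENNReal.ofReal (g x) ∂ν = ∫⁻ x, liminf (fun n => ENNReal.ofReal (f n x)) atTop ∂ν := by
        refine lintegral_congr_ae ?_
        filter_upwards [hlim] with x hx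
        exact (ENNReal.tendsto_ofReal hx).liminf_eq.symm
    _ ≤ liminf (fun n => ∫⁻ x, ENNReal.ofReal (f n x) ∂ν) atTop :=
        lintegral_liminf_le' fun n => (hf n).1.aemeasurable.ennreal_ofReal
    _ ≤ liminf (fun n => ENNReal.ofReal (c n)) atTop := by
        refine liminf_le_liminf (.of_forall fun n => ?_)
        rw [← ofReal_integral_eq_lintegral_ofReal (hf n) (.of_forall (hf0 n))]
        exact ENNReal.ofReal_le_ofReal (hc n)
    _ = ENNReal.ofReal l := (ENNReal.tendsto_ofReal hl).liminf_eq

/-- No mass is lost in an a.e. limit if a power larger than one is bounded in `L¹`. -/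
lemma le_integral_of_ae_tendsto [IsFiniteMeasure ν] (hf0 : ∀ n x, 0 ≤ f n x)
    (hf : ∀ n, Integrable (f n) ν) (hg : Integrable g ν)
    (hlim : ∀ᵐ x ∂ν, Tendsto (fun n => f n x) atTop (𝓝 (g x))) {τ C : ℝ} (hτ : 0 < τ)
    (hi : ∀ n, Integrable (fun x => f n x ^ (1 + τ)) ν) (hC : ∀ n, ∫ x, f n x ^ (1 + τ) ∂ν ≤ C)
    {l : ℝ} (hl : Tendsto (fun n => ∫ x, f n x ∂ν) atTop (𝓝 l)) : l ≤ ∫ x, g x ∂ν := by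
  -- Splitting at height K: f ≤ min(f, K) + f^(1+τ) K^(-τ). Dominated convergence handles the
  -- truncated part, and K → ∞ removes the remainder.
  have key : ∀ K : ℝ, 0 < K → l ≤ ∫ x, g x ∂ν + C * K ^ (-τ) := by
    intro K hK
    have hmin : ∀ n, Integrable (fun x => min (f n x) K) ν := fun n =>
      (hf n).inf (integrable_const K)
    have h1 : Tendsto (fun n => ∫ x, min (f n x) K ∂ν) atTop (𝓝 (∫ x, min (g x) K ∂ν)) := by
      refine tendsto_integral_of_dominated_convergence (fun _ => K) (fun n => (hmin n).1)
        (integrable_const K) (fun n => .of_forall fun x => ?_) ?_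
      · rw [Real.norm_of_nonneg (le_min (hf0 n x) hK.le)]
        exact min_le_right _ _
      · filter_upwards [hlim] with x hx
        exact hx.min tendsto_const_nhds
    have h2 : ∫ x, min (g x) K ∂ν ≤ ∫ x, g x ∂ν :=
      integral_mono (hg.inf (integrable_const K)) hg fun x => min_le_left _ _
    refine (le_of_tendsto_of_tendsto' hl (h1.add_const (C * K ^ (-τ))) fun n => ?_).trans
      (add_le_add_left h2 _)
    calc ∫ x, f n x ∂ν ≤ ∫ x, (min (f n x) K + f n x ^ (1 + τ) * K ^ (-τ)) ∂ν := by
          refine integral_mono (hf n) ((hmin n).add ((hi n).mul_const _)) fun x => ?_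
          have h0 := hf0 n x
          rcases le_or_gt (f n x) K with h | h
          · simp only [min_eq_left h]
            have : 0 ≤ f n x ^ (1 + τ) * K ^ (-τ) := by positivity
            linarith
          · have hp : 0 < f n x := hK.trans h
            have h3 : 1 ≤ (f n x / K) ^ τ :=
              Real.one_le_rpow ((one_le_div hK).2 h.le) hτ.le
            have h4 : f n x ^ (1 + τ) * K ^ (-τ) = f n x * (f n x / K) ^ τ := by
              rw [Real.rpow_add hp, Real.rpow_one, Real.div_rpow hp.le hK.le, Real.rpow_neg hK.le]
              ring
            simp only [h4, min_eq_right h.le]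
            nlinarith
      _ = ∫ x, min (f n x) K ∂ν + (∫ x, f n x ^ (1 + τ) ∂ν) * K ^ (-τ) := by
          rw [integral_add (hmin n) ((hi n).mul_const _), integral_mul_const]
      _ ≤ _ := by
          gcongr
          exact hC n
  have hlim : Tendsto (fun K : ℝ => ∫ x, g x ∂ν + C * K ^ (-τ)) atTop
      (𝓝 (∫ x, g x ∂ν + C * 0)) := ((tendsto_rpow_neg_atTop hτ).const_mul C).const_add _
  rw [mul_zero, add_zero] at hlim
  exact ge_of_tendsto hlim ((eventually_gt_atTop 0).mono key)

end Convergence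

end FracChoquard

end

/-! ### Existence of a maximizer. -/

noncomputable section

namespace FracChoquard

variable {N : ℕ} {s : ℝ} {Ω : Set (EuclideanSpace ℝ (Fin N))} {u v : EuclideanSpace ℝ (Fin N) → ℝ}
  {μ p q a b c : ℝ}

lemma tendsto_integral_mul_of_tendsto_toLp {u v : ℕ → EuclideanSpace ℝ (Fin N) → ℝ}
    {u' v' : EuclideanSpace ℝ (Fin N) → ℝ} (hu : ∀ k, MemLp (u k) 2 volume)
    (hv : ∀ k, MemLp (v k) 2 volume) (hu' : MemLp u' 2 volume) (hv' : MemLp v' 2 volume)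
    (h1 : Tendsto (fun k => (hu k).toLp (u k)) atTop (𝓝 (hu'.toLp u')))
    (h2 : Tendsto (fun k => (hv k).toLp (v k)) atTop (𝓝 (hv'.toLp v'))) :
    Tendsto (fun k => ∫ x, u k x * v k x) atTop (𝓝 (∫ x, u' x * v' x)) := by
  have e : ∀ {f g : EuclideanSpace ℝ (Fin N) → ℝ} (hf : MemLp f 2 volume) (hg : MemLp g 2 volume),
      inner ℝ (hf.toLp f) (hg.toLp g) = ∫ x, f x * g x := by
    intro f g hf hg
    rw [L2.inner_def]
    refine integral_congr_ae ?_
    filter_upwards [hf.coeFn_toLp, hg.coeFn_toLp] with x hx hx'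
    rw [hx, hx']
    simp [mul_comm]
  have := h1.inner (𝕜 := ℝ) h2
  simpa only [e] using this

/-- The set of admissible pairs with bounded energy is sequentially compact, and the Choquard
energy does not drop in the limit. -/
lemma Subcritical.exists_limit (h : Subcritical s Ω μ p q) {δ : ℝ} (hδ : 0 < δ)
    (hco : ∀ u v : EuclideanSpace ℝ (Fin N) → ℝ, MemX s Ω u → MemX s Ω v →
      δ * (innerX s u u + innerX s v v) ≤ quadEnergy s a b c u v)
    {u v : ℕ → EuclideanSpace ℝ (Fin N) → ℝ} (hu : ∀ n, MemX s Ω (u n)) (hv : ∀ n, MemX s Ω (v n))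
    (hQ : ∀ n, quadEnergy s a b c (u n) (v n) ≤ 1) {M : ℝ}
    (hM : Tendsto (fun n => choquardEnergy Ω μ p q (u n) (v n)) atTop (𝓝 M)) :
    ∃ u' v' : EuclideanSpace ℝ (Fin N) → ℝ, MemX s Ω u' ∧ MemX s Ω v' ∧
      quadEnergy s a b c u' v' ≤ 1 ∧ M ≤ choquardEnergy Ω μ p q u' v' := by
  have hsum : ∀ n, innerX s (u n) (u n) + innerX s (v n) (v n) ≤ 1 / δ := fun n => by
    rw [le_div_iff₀ hδ, mul_comm]
    exact (hco _ _ (hu n) (hv n)).trans (hQ n)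
  have hRu : ∀ n, innerX s (u n) (u n) ≤ 1 / δ := fun n => by
    linarith [hsum n, innerX_self_nonneg (s := s) (v n)]
  have hRv : ∀ n, innerX s (v n) (v n) ≤ 1 / δ := fun n => by
    linarith [hsum n, innerX_self_nonneg (s := s) (u n)]
  have hΩm := h.isOpen.measurableSet
  obtain ⟨u', hu', ns, hns, hLu, hau⟩ :=
    exists_subseq_tendsto h.s_pos h.two_mul_s_lt hΩm h.isBounded hu hRu
  obtain ⟨v', hv', ms, hms, hLv, hav⟩ :=
    exists_subseq_tendsto h.s_pos h.two_mul_s_lt hΩm h.isBounded (fun k => hv (ns k))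
      (fun k => hRv (ns k))
  replace hLu := hLu.comp hms.tendsto_atTop
  replace hau : ∀ᵐ x, Tendsto (fun k => u (ns (ms k)) x) atTop (𝓝 (u' x)) := by
    filter_upwards [hau] with x hx
    exact hx.comp hms.tendsto_atTop
  replace hM := hM.comp (hns.comp hms).tendsto_atTop
  refine ⟨u', v', hu', hv', ?_, ?_⟩
  · have h1 := tendsto_integral_mul_of_tendsto_toLp (fun k => (hu (ns (ms k))).memLp)
      (fun k => (hu (ns (ms k))).memLp) hu'.memLp hu'.memLp hLu hLu
    have h2 := tendsto_integral_mul_of_tendsto_toLp (fun k => (hu (ns (ms k))).memLp)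
      (fun k => (hv (ns (ms k))).memLp) hu'.memLp hv'.memLp hLu hLv
    have h3 := tendsto_integral_mul_of_tendsto_toLp (fun k => (hv (ns (ms k))).memLp)
      (fun k => (hv (ns (ms k))).memLp) hv'.memLp hv'.memLp hLv hLv
    -- The constraint is rewritten as a bound on the seminorms by 1 plus the zero-order terms, which
    -- converge by L² convergence; Fatou then applies to the seminorms.
    have hlim := (((h1.const_mul a).add (h2.const_mul (2 * b))).add (h3.const_mul c)).const_add 1
    have hle := integral_le_of_ae_tendsto (ν := volume)
      (f := fun k z => diffQuot s (u (ns (ms k))) z * diffQuot s (u (ns (ms k))) z +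
        diffQuot s (v (ns (ms k))) z * diffQuot s (v (ns (ms k))) z)
      (g := fun z => diffQuot s u' z * diffQuot s u' z + diffQuot s v' z * diffQuot s v' z)
      (fun k z => add_nonneg (mul_self_nonneg _) (mul_self_nonneg _))
      (fun k => ((hu _).integrable_diffQuot_mul (hu _)).add
        ((hv _).integrable_diffQuot_mul (hv _)))
      ((hu'.integrable_diffQuot_mul hu').add (hv'.integrable_diffQuot_mul hv'))
      (by
        filter_upwards [tendsto_diffQuot (s := s) hau, tendsto_diffQuot (s := s) hav] with z h1 h2
        exact (h1.mul h1).add (h2.mul h2))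
      (fun k => by
        rw [integral_add ((hu _).integrable_diffQuot_mul (hu _))
          ((hv _).integrable_diffQuot_mul (hv _)), ← innerX_eq, ← innerX_eq]
        have := hQ (ns (ms k))
        simp only [quadEnergy, sq] at this
        linarith) hlim
    rw [integral_add (hu'.integrable_diffQuot_mul hu') (hv'.integrable_diffQuot_mul hv'),
      ← innerX_eq, ← innerX_eq] at hle
    simp only [quadEnergy, sq]
    linarith
  · have hfin : IsFiniteMeasure (volume.restrict Ω) := ⟨by
      rw [Measure.restrict_apply_univ]
      exact h.volume_ne_top.lt_top⟩
    -- Boundedness of the energy with scaled parameters gives the uniform integrability that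
    -- prevents loss of mass.
    obtain ⟨τ, hτ, hs⟩ := h.exists_scaled
    obtain ⟨C, hC0, hC⟩ := hs.exists_choquardEnergy_le
    have hp0 : 0 ≤ p * (1 + τ) := (one_pos.trans hs.one_lt_p).le
    have hq0 : 0 ≤ q * (1 + τ) := (one_pos.trans hs.one_lt_q).le
    refine le_integral_of_ae_tendsto (τ := τ)
      (C := C * √(1 / δ) ^ (p * (1 + τ)) * √(1 / δ) ^ (q * (1 + τ)))
      (fun k z => choquardIntegrand_nonneg μ p q (u (ns (ms k))) (v (ns (ms k))) z)
      (fun k => h.integrable (hu _) (hv _)) (h.integrable hu' hv') ?_ hτ (fun k => ?_)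
      (fun k => ?_) hM
    · have h1 : ∀ᵐ z ∂((volume.restrict Ω).prod (volume.restrict Ω)),
          Tendsto (fun k => u (ns (ms k)) z.1) atTop (𝓝 (u' z.1)) :=
        Measure.quasiMeasurePreserving_fst.ae (ae_restrict_of_ae hau)
      have h2 : ∀ᵐ z ∂((volume.restrict Ω).prod (volume.restrict Ω)),
          Tendsto (fun k => v (ns (ms k)) z.2) atTop (𝓝 (v' z.2)) :=
        Measure.quasiMeasurePreserving_snd.ae (ae_restrict_of_ae hav)
      filter_upwards [h1, h2] with z h1 h2
      exact (h1.abs.rpow_const (.inr (one_pos.trans h.one_lt_p).le)).mul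
        ((h2.abs.rpow_const (.inr (one_pos.trans h.one_lt_q).le)).div_const _)
    · simp only [choquardIntegrand_rpow]
      exact hs.integrable (hu _) (hv _)
    · simp only [choquardIntegrand_rpow]
      refine (hC _ _ (hu _) (hv _)).trans ?_
      gcongr
      · exact hRu _
      · exact hRv _

/-- Off the diagonal the integrand is positive on Ω × Ω, so a zero integral would make Ω a null set.
It supplies a competitor showing that the maximum is positive. -/
lemma choquardEnergy_pos (h : Subcritical s Ω μ p q) (hne : Ω.Nonempty)
    (hu : MemX s Ω u) (hpos : ∀ x ∈ Ω, 0 < u x) : 0 < choquardEnergy Ω μ p q u u := by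
  have : Nontrivial (EuclideanSpace ℝ (Fin N)) := by
    refine Module.nontrivial_of_finrank_pos (R := ℝ) ?_
    rw [finrank_euclideanSpace_fin]
    have : (0 : ℝ) < N := h.mu_pos.trans h.mu_lt
    exact_mod_cast this
  refine lt_of_le_of_ne (choquardEnergy_nonneg _ _ _ _ _ _) fun h0 => ?_
  have h1 := (integral_eq_zero_iff_of_nonneg (fun z => choquardIntegrand_nonneg μ p q u u z)
    (h.integrable hu hu)).1 h0.symm
  have hfst : ∀ᵐ z ∂((volume.restrict Ω).prod (volume.restrict Ω)), z.1 ∈ Ω :=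
    Measure.quasiMeasurePreserving_fst.ae (ae_restrict_mem h.isOpen.measurableSet)
  have hsnd : ∀ᵐ z ∂((volume.restrict Ω).prod (volume.restrict Ω)), z.2 ∈ Ω :=
    Measure.quasiMeasurePreserving_snd.ae (ae_restrict_mem h.isOpen.measurableSet)
  -- On the diagonal division by zero gives the integrand the value 0, so this null set must be
  -- removed.
  have hdiag : ∀ᵐ z ∂((volume.restrict Ω).prod (volume.restrict Ω)), z.1 ≠ z.2 := by
    have hm : MeasurableSet {z : EuclideanSpace ℝ (Fin N) × EuclideanSpace ℝ (Fin N) | z.1 = z.2} :=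
      measurableSet_eq_fun measurable_fst measurable_snd
    rw [ae_iff]
    simp only [ne_eq, not_not]
    rw [Measure.measure_prod_null hm]
    refine .of_forall fun x => ?_
    have : Prod.mk x ⁻¹' {z : EuclideanSpace ℝ (Fin N) × EuclideanSpace ℝ (Fin N) | z.1 = z.2} =
        {x} := by
      ext y
      simp [eq_comm]
    simp only [this, measure_singleton, Pi.zero_apply]
  have hfalse : ∀ᵐ z ∂((volume.restrict Ω).prod (volume.restrict Ω)), False := by
    filter_upwards [h1, hfst, hsnd, hdiag] with z h1 h2 h3 h4
    have h5 : 0 < ‖z.1 - z.2‖ := norm_pos_iff.2 (sub_ne_zero.2 h4)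
    have h6 : 0 < |u z.1| := abs_pos.2 (hpos _ h2).ne'
    have h7 : 0 < |u z.2| := abs_pos.2 (hpos _ h3).ne'
    have : 0 < choquardIntegrand μ p q u u z := by
      unfold choquardIntegrand
      positivity
    exact this.ne' h1
  rw [ae_iff] at hfalse
  simp only [not_false_eq_true, Set.ofPred_true] at hfalse
  rw [← Set.univ_prod_univ, Measure.prod_prod, Measure.restrict_apply_univ,
    mul_self_eq_zero] at hfalse
  exact (h.isOpen.measure_pos volume hne).ne' hfalse

/-- The Choquard energy has a nonnegative maximizer relative to the quadratic energy. -/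
theorem Subcritical.exists_maximizer (h : Subcritical s Ω μ p q) (hs1 : s < 1) (hne : Ω.Nonempty)
    (hb : 0 ≤ b) {δ : ℝ} (hδ : 0 < δ)
    (hco : ∀ u v : EuclideanSpace ℝ (Fin N) → ℝ, MemX s Ω u → MemX s Ω v →
      δ * (innerX s u u + innerX s v v) ≤ quadEnergy s a b c u v) :
    ∃ (u v : EuclideanSpace ℝ (Fin N) → ℝ) (M : ℝ), MemX s Ω u ∧ MemX s Ω v ∧ (∀ x, 0 ≤ u x) ∧
      (∀ x, 0 ≤ v x) ∧ 0 < M ∧ quadEnergy s a b c u v = 1 ∧ choquardEnergy Ω μ p q u v = M ∧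
      ∀ u' v' : EuclideanSpace ℝ (Fin N) → ℝ, MemX s Ω u' → MemX s Ω v' →
        choquardEnergy Ω μ p q u' v' ≤ M * quadEnergy s a b c u' v' ^ ((p + q) / 2) := by
  have hp0 := one_pos.trans h.one_lt_p
  have hq0 := one_pos.trans h.one_lt_q
  have hN1 : 1 ≤ N := by
    have : (0 : ℝ) < N := h.mu_pos.trans h.mu_lt
    exact_mod_cast this
  obtain ⟨C, hC0, hC⟩ := h.exists_choquardEnergy_le
  have hQ0 : ∀ u v : EuclideanSpace ℝ (Fin N) → ℝ, MemX s Ω u → MemX s Ω v →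
      0 ≤ quadEnergy s a b c u v := fun u v hu hv =>
    (mul_nonneg hδ.le (add_nonneg (innerX_self_nonneg u) (innerX_self_nonneg v))).trans
      (hco u v hu hv)
  -- The constraint is an inequality since only this survives weak limits; equality is recovered at
  -- the end.
  let T : Set ℝ := {r | ∃ u v : EuclideanSpace ℝ (Fin N) → ℝ, MemX s Ω u ∧ MemX s Ω v ∧
    quadEnergy s a b c u v ≤ 1 ∧ choquardEnergy Ω μ p q u v = r}
  have hbd : BddAbove T := by
    refine ⟨C * √(1 / δ) ^ p * √(1 / δ) ^ q, ?_⟩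
    rintro r ⟨u, v, hu, hv, hQ, rfl⟩
    have hsum : innerX s u u + innerX s v v ≤ 1 / δ := by
      rw [le_div_iff₀ hδ, mul_comm]
      exact (hco _ _ hu hv).trans hQ
    refine (hC u v hu hv).trans ?_
    gcongr
    · linarith [innerX_self_nonneg (s := s) v]
    · linarith [innerX_self_nonneg (s := s) u]
  obtain ⟨η, K, hη, -, -, hηpos, -⟩ :=
    exists_memX_pos h.s_pos hs1 hN1 h.isOpen h.isBounded
  have hTne : T.Nonempty := by
    refine ⟨_, (0 : ℝ) • η, (0 : ℝ) • η, hη.smul 0, hη.smul 0, ?_, rfl⟩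
    rw [quadEnergy_smul]
    norm_num
  obtain ⟨r, -, hr, hrT⟩ := exists_seq_tendsto_sSup hTne hbd
  choose us vs hus hvs hQs hrs using hrT
  obtain ⟨u, v, hu, hv, hQ, hM⟩ := h.exists_limit hδ hco hus hvs hQs
    (M := sSup T) (by simpa only [hrs] using hr)
  have hQa := (quadEnergy_abs_le (a := a) (c := c) hb hu hv).trans hQ
  have hMeq : choquardEnergy Ω μ p q (fun x => |u x|) (fun x => |v x|) = sSup T := by
    refine le_antisymm (le_csSup hbd ⟨_, _, hu.abs, hv.abs, hQa, rfl⟩) ?_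
    rwa [choquardEnergy_abs]
  have hhom : ∀ u' v' : EuclideanSpace ℝ (Fin N) → ℝ, MemX s Ω u' → MemX s Ω v' →
      choquardEnergy Ω μ p q u' v' ≤ sSup T * quadEnergy s a b c u' v' ^ ((p + q) / 2) := by
    intro u' v' hu' hv'
    -- A pair of zero quadratic energy has zero seminorms by coercivity, hence zero Choquard energy;
    -- any other pair is normalized to quadratic energy 1.
    rcases (hQ0 u' v' hu' hv').eq_or_lt with h0 | hpos
    · have h1 := hco u' v' hu' hv'
      rw [← h0] at h1
      have h2 : innerX s u' u' = 0 := by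
        refine le_antisymm ?_ (innerX_self_nonneg u')
        by_contra! h3
        have := mul_pos hδ (add_pos_of_pos_of_nonneg h3 (innerX_self_nonneg (s := s) v'))
        linarith
      have h3 := hC u' v' hu' hv'
      rw [h2, Real.sqrt_zero, Real.zero_rpow hp0.ne', mul_zero, zero_mul] at h3
      rwa [← h0, Real.zero_rpow (by positivity), mul_zero]
    · set Q := quadEnergy s a b c u' v'
      have ht : 0 < Q ^ (-(1 / 2) : ℝ) := by positivity
      have h1 : choquardEnergy Ω μ p q (Q ^ (-(1 / 2) : ℝ) • u') (Q ^ (-(1 / 2) : ℝ) • v') ≤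
          sSup T := by
        refine le_csSup hbd ⟨_, _, hu'.smul _, hv'.smul _, ?_, rfl⟩
        rw [quadEnergy_smul, ← Real.rpow_natCast, ← Real.rpow_mul hpos.le]
        norm_num
        rw [Real.rpow_neg_one, inv_mul_cancel₀ hpos.ne']
      rw [choquardEnergy_smul ht, ← Real.rpow_mul hpos.le,
        show -(1 / 2) * (p + q) = -((p + q) / 2) by ring, Real.rpow_neg hpos.le,
        inv_mul_le_iff₀ (by positivity)] at h1
      linarith
  have hMpos : 0 < sSup T := by
    have h1 := (choquardEnergy_pos h hne hη hηpos).trans_le (hhom η η hη hη)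
    exact pos_of_mul_pos_left h1 (Real.rpow_nonneg (hQ0 η η hη hη) _)
  refine ⟨fun x => |u x|, fun x => |v x|, sSup T, hu.abs, hv.abs, fun x => abs_nonneg _,
    fun x => abs_nonneg _, hMpos, le_antisymm hQa ?_, hMeq, hhom⟩
  -- If the constraint were slack, homogeneity would give M ≤ M Q^((p+q)/2) < M.
  by_contra! hlt
  have h1 := hhom _ _ hu.abs hv.abs
  rw [hMeq] at h1
  have h2 := Real.rpow_lt_one (hQ0 _ _ hu.abs hv.abs) hlt (by positivity : 0 < (p + q) / 2)
  nlinarith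

end FracChoquard

end

/-! ### The strong maximum principle. -/

noncomputable section

namespace FracChoquard

variable {N : ℕ} {s : ℝ} {Ω : Set (EuclideanSpace ℝ (Fin N))} {u v : EuclideanSpace ℝ (Fin N) → ℝ}

/-- With A = A⁺ - A⁻ and B = B⁺ - B⁻ the right side equals A⁺B⁻ + A⁻B⁺, of which one nonnegative
term is dropped. -/
lemma max_mul_max_neg_le (A B : ℝ) :
    max A 0 * max (-B) 0 ≤
      (A - B) * (max A 0 - max B 0) - (max A 0 - max B 0) * (max A 0 - max B 0) := by
  rcases le_total A 0 with hA | hA <;> rcases le_total B 0 with hB | hB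
  · simp [hA, hB]
  · simp only [max_eq_right hA, max_eq_left hB, zero_mul]
    nlinarith
  · simp only [max_eq_left hA, max_eq_right hB, max_eq_left (neg_nonneg.2 hB)]
    nlinarith
  · simp only [max_eq_left hA, max_eq_left hB, max_eq_right (neg_nonpos.2 hB)]
    nlinarith

/-- Expansion of the square of v - (ε/2)u. The coefficient 1 of the energy of v is what later
cancels the energy of the test function. -/
lemma innerX_le_add (hu : MemX s Ω u) (hv : MemX s Ω v) (ε : ℝ) :
    ε * innerX s u v ≤ innerX s v v + ε ^ 2 / 4 * innerX s u u := by
  have h1 := innerX_add_smul_self hv hu (-(ε / 2))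
  have h2 := innerX_self_nonneg (s := s) (v + (-(ε / 2)) • u)
  rw [innerX_comm v u] at h1
  linarith

/-- The nonlocal interaction between the sets `{u < εη}` and `{u > εη}` is of order `ε²` for a
nonnegative supersolution `u`. -/
lemma integral_interaction_le {η : EuclideanSpace ℝ (Fin N) → ℝ} (hu : MemX s Ω u)
    (hη : MemX s Ω η) (hu0 : ∀ x, 0 ≤ u x) (hη0 : ∀ x, 0 ≤ η x) {C : ℝ} (hC : 0 ≤ C)
    (hsup : ∀ φ : EuclideanSpace ℝ (Fin N) → ℝ, MemX s Ω φ → (∀ x, 0 ≤ φ x) →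
      -(C * ∫ x, u x * φ x) ≤ innerX s u φ) {ε : ℝ} (hε : 0 < ε) :
    Integrable (fun z => diffQuot s (ε • η - u) z *
        diffQuot s (fun x => max ((ε • η - u) x) 0) z -
      diffQuot s (fun x => max ((ε • η - u) x) 0) z *
        diffQuot s (fun x => max ((ε • η - u) x) 0) z) volume ∧
    ∫ z, (diffQuot s (ε • η - u) z * diffQuot s (fun x => max ((ε • η - u) x) 0) z -
      diffQuot s (fun x => max ((ε • η - u) x) 0) z *
        diffQuot s (fun x => max ((ε • η - u) x) 0) z) ≤
      ε ^ 2 * (innerX s η η / 4 + C * ∫ x, η x ^ 2) := by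
  have hw : MemX s Ω (ε • η - u) := (hη.smul ε).sub hu
  have hφ := hw.posPart
  set φ : EuclideanSpace ℝ (Fin N) → ℝ := fun x => max ((ε • η - u) x) 0 with hφdef
  have i1 := hw.integrable_diffQuot_mul hφ
  have i2 := hφ.integrable_diffQuot_mul hφ
  refine ⟨i1.sub i2, ?_⟩
  rw [integral_sub i1 i2, ← innerX_eq, ← innerX_eq]
  have h1 : innerX s (ε • η - u) φ = ε * innerX s η φ - innerX s u φ := by
    have := innerX_add_left (hη.smul ε) (hu.smul (-1)) hφ
    rw [innerX_smul_left, innerX_smul_left, neg_one_smul, ← sub_eq_add_neg] at this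
    linarith
  have h2 := hsup φ hφ fun x => le_max_right _ _
  have h3 := innerX_le_add hη hφ ε
  -- Where φ is nonzero, both u and φ lie between 0 and εη, so the zero-order term is also of order
  -- ε².
  have h4 : ∫ x, u x * φ x ≤ ε ^ 2 * ∫ x, η x ^ 2 := by
    rw [← integral_const_mul]
    refine integral_mono (hu.integrable_mul hφ) (hη.memLp.integrable_sq.const_mul _) fun x => ?_
    simp only [hφdef, Pi.sub_apply, Pi.smul_apply, smul_eq_mul]
    have hη0' := hη0 x
    have hu0' := hu0 x
    rcases le_total (ε * η x - u x) 0 with h | h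
    · rw [max_eq_right h, mul_zero]
      positivity
    · rw [max_eq_left h]
      have h5 : u x ≤ ε * η x := by linarith
      have h6 : ε * η x - u x ≤ ε * η x := by linarith
      calc u x * (ε * η x - u x) ≤ (ε * η x) * (ε * η x) := by gcongr
        _ = ε ^ 2 * η x ^ 2 := by ring
  have h5 : C * ∫ x, u x * φ x ≤ C * (ε ^ 2 * ∫ x, η x ^ 2) := mul_le_mul_of_nonneg_left h4 hC
  linarith

/-- The strong maximum principle for the fractional Laplacian: nonnegative nontrivial
supersolutions are positive. -/
theorem ae_pos_of_supersolution (hs0 : 0 < s) (hs1 : s < 1) (hN : 1 ≤ N) (hΩ : IsOpen Ω)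
    (hΩb : Bornology.IsBounded Ω) (hu : MemX s Ω u) (hu0 : ∀ x, 0 ≤ u x)
    (hne : ¬ u =ᵐ[volume] 0) {C : ℝ} (hC : 0 ≤ C)
    (hsup : ∀ φ : EuclideanSpace ℝ (Fin N) → ℝ, MemX s Ω φ → (∀ x, 0 ≤ φ x) →
      -(C * ∫ x, u x * φ x) ≤ innerX s u φ) :
    ∀ᵐ x ∂(volume.restrict Ω), 0 < u x := by
  obtain ⟨η, K, hη, hηm, hηK, hηpos, -⟩ := exists_memX_pos hs0 hs1 hN hΩ hΩb
  have hη0 : ∀ x, 0 ≤ η x := fun x => (hηK x).1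
  set C' := innerX s η η / 4 + C * ∫ x, η x ^ 2
  let g := hu.memLp.1.mk u
  have hg : Measurable g := hu.memLp.1.stronglyMeasurable_mk.measurable
  have hug : ∀ᵐ x, u x = g x := hu.memLp.1.ae_eq_mk
  let Z : Set (EuclideanSpace ℝ (Fin N)) := Ω ∩ {x | g x = 0}
  have hZ : MeasurableSet Z := hΩ.measurableSet.inter (hg (measurableSet_singleton 0))
  have hZu : ∀ᵐ z : EuclideanSpace ℝ (Fin N) × EuclideanSpace ℝ (Fin N), z.1 ∈ Z → u z.1 = 0 := by
    have h1 : ∀ᵐ z : EuclideanSpace ℝ (Fin N) × EuclideanSpace ℝ (Fin N), u z.1 = g z.1 :=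
      Measure.quasiMeasurePreserving_fst.ae hug
    filter_upwards [h1] with z h hz
    rw [h]
    exact hz.2
  -- On the zero set Z of u the positive part of εη - u is εη. Hence ε f(ε) is the interaction of Z
  -- with {u > εη}, and the ε² bound gives ∫ f(ε) = O(ε).
  let f : ℝ → EuclideanSpace ℝ (Fin N) × EuclideanSpace ℝ (Fin N) → ℝ := fun ε z =>
    Z.indicator η z.1 * max (u z.2 - ε * η z.2) 0 / ‖z.1 - z.2‖ ^ ((N : ℝ) + 2 * s)
  have hind : ∀ x, 0 ≤ Z.indicator η x := fun x => Set.indicator_nonneg (fun y _ => hη0 y) x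
  have hf0 : ∀ ε z, 0 ≤ f ε z := fun ε z =>
    div_nonneg (mul_nonneg (hind _) (le_max_right _ _)) (by positivity)
  have hfm : ∀ ε, AEStronglyMeasurable (f ε) volume := by
    intro ε
    have h1 : AEMeasurable (fun z : EuclideanSpace ℝ (Fin N) × EuclideanSpace ℝ (Fin N) =>
        Z.indicator η z.1) volume := ((hηm.indicator hZ).comp measurable_fst).aemeasurable
    have h2 : AEMeasurable (fun z : EuclideanSpace ℝ (Fin N) × EuclideanSpace ℝ (Fin N) =>
        u z.2) volume := hu.memLp.1.comp_snd.aemeasurable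
    have h3 : Measurable (fun z : EuclideanSpace ℝ (Fin N) × EuclideanSpace ℝ (Fin N) =>
        ε * η z.2) := (hηm.comp measurable_snd).const_mul ε
    have h4 : Measurable (fun z : EuclideanSpace ℝ (Fin N) × EuclideanSpace ℝ (Fin N) =>
        ‖z.1 - z.2‖ ^ ((N : ℝ) + 2 * s)) := by fun_prop
    exact ((h1.mul ((h2.sub h3.aemeasurable).max aemeasurable_const)).div
      h4.aemeasurable).aestronglyMeasurable
  have hle : ∀ ε, 0 < ε → ∀ᵐ z, ε * f ε z ≤
      diffQuot s (ε • η - u) z * diffQuot s (fun x => max ((ε • η - u) x) 0) z -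
      diffQuot s (fun x => max ((ε • η - u) x) 0) z *
        diffQuot s (fun x => max ((ε • η - u) x) 0) z := by
    intro ε hε
    filter_upwards [hZu] with z hz
    rw [diffQuot_mul, diffQuot_mul, ← sub_div, mul_div_assoc']
    refine div_le_div_of_nonneg_right (le_trans ?_ (max_mul_max_neg_le _ _)) (by positivity)
    rw [← mul_assoc]
    simp only [Pi.sub_apply, Pi.smul_apply, smul_eq_mul, neg_sub]
    refine mul_le_mul_of_nonneg_right ?_ (le_max_right _ _)
    by_cases h : z.1 ∈ Z
    · rw [Set.indicator_of_mem h, hz h, sub_zero]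
      exact le_max_left _ _
    · rw [Set.indicator_of_notMem h, mul_zero]
      exact le_max_right _ _
  have hfi : ∀ ε, 0 < ε → Integrable (f ε) volume := by
    intro ε hε
    have h1 : Integrable (fun z => ε * f ε z) volume := by
      refine (integral_interaction_le hu hη hu0 hη0 hC hsup hε).1.mono'
        ((hfm ε).const_mul ε) ?_
      filter_upwards [hle ε hε] with z hz
      rwa [Real.norm_of_nonneg (mul_nonneg hε.le (hf0 ε z))]
    exact (integrable_const_mul_iff (isUnit_iff_ne_zero.2 hε.ne') _).1 h1
  have hbound : ∀ ε, 0 < ε → ∫ z, f ε z ≤ ε * C' := by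
    intro ε hε
    have h1 := integral_interaction_le hu hη hu0 hη0 hC hsup hε
    have h2 := (integral_mono_ae ((hfi ε hε).const_mul ε) h1.1 (hle ε hε)).trans h1.2
    rw [integral_const_mul] at h2
    refine le_of_mul_le_mul_left (h2.trans (le_of_eq ?_)) hε
    ring
  -- f increases as ε decreases, so the integral at a fixed ε₀ is bounded by the limit 0 of those at
  -- smaller ε.
  have hzero : ∀ ε, 0 < ε → f ε =ᵐ[volume] 0 := by
    intro ε₀ hε₀
    refine (integral_eq_zero_iff_of_nonneg (hf0 ε₀) (hfi ε₀ hε₀)).1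
      (le_antisymm ?_ (integral_nonneg (hf0 ε₀)))
    have hlim : Tendsto (fun ε : ℝ => ε * C') (𝓝[>] 0) (𝓝 0) := by
      have : ContinuousAt (fun ε : ℝ => ε * C') 0 := by fun_prop
      simpa using this.tendsto.mono_left nhdsWithin_le_nhds
    refine ge_of_tendsto hlim ?_
    filter_upwards [Ioc_mem_nhdsGT hε₀] with ε hε
    refine (integral_mono (hfi ε₀ hε₀) (hfi ε hε.1) fun z => ?_).trans (hbound ε hε.1)
    have h1 := mul_le_mul_of_nonneg_right hε.2 (hη0 z.2)
    exact div_le_div_of_nonneg_right (mul_le_mul_of_nonneg_left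
      (max_le_max (by linarith) le_rfl) (hind _)) (by positivity)
  have hprod : ∀ᵐ z : EuclideanSpace ℝ (Fin N) × EuclideanSpace ℝ (Fin N),
      z.1 ∈ Z → u z.2 = 0 := by
    have h1 : ∀ᵐ z, ∀ n : ℕ, f (1 / ((n : ℝ) + 1)) z = 0 :=
      ae_all_iff.2 fun n => hzero _ (by positivity)
    filter_upwards [h1, hZu] with z h1 h2 hz
    rcases eq_or_ne z.1 z.2 with h | h
    · rw [← h]
      exact h2 hz
    · have hk : 0 < ‖z.1 - z.2‖ := norm_pos_iff.2 (sub_ne_zero.2 h)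
      have hn : ∀ n : ℕ, u z.2 ≤ 1 / ((n : ℝ) + 1) * η z.2 := by
        intro n
        have h3 := h1 n
        simp only [f] at h3
        rw [div_eq_zero_iff, or_iff_left (by positivity), Set.indicator_of_mem hz, mul_eq_zero,
          or_iff_right (hηpos _ hz.1).ne'] at h3
        linarith [le_max_left (u z.2 - 1 / ((n : ℝ) + 1) * η z.2) 0]
      have hlim : Tendsto (fun n : ℕ => 1 / ((n : ℝ) + 1) * η z.2) atTop (𝓝 (0 * η z.2)) :=
        tendsto_one_div_add_atTop_nhds_zero_nat.mul_const _
      rw [zero_mul] at hlim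
      exact le_antisymm (ge_of_tendsto' hlim hn) (hu0 _)
  -- One slice through a point of Z would make u vanish almost everywhere.
  have hZ0 : ∀ᵐ x, x ∉ Z := by
    have h1 := Measure.ae_ae_of_ae_prod (hprod : ∀ᵐ z ∂(volume.prod volume), _)
    filter_upwards [h1] with x hx hxZ
    refine hne ?_
    filter_upwards [hx] with y hy
    exact hy hxZ
  filter_upwards [ae_restrict_mem hΩ.measurableSet, ae_restrict_of_ae hZ0,
    ae_restrict_of_ae hug] with x h1 h2 h3
  refine lt_of_le_of_ne (hu0 x) fun h => h2 ⟨h1, ?_⟩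
  simp only [Set.mem_ofPred_eq]
  rw [← h3, ← h]

end FracChoquard

end

/-! ### The Euler–Lagrange equations and the rescaling. -/

noncomputable section

namespace FracChoquard

variable {N : ℕ} {s : ℝ} {Ω : Set (EuclideanSpace ℝ (Fin N))} {u v φ : EuclideanSpace ℝ (Fin N) → ℝ}
  {μ p q a b c : ℝ}

lemma potential_nonneg (Ω : Set (EuclideanSpace ℝ (Fin N))) (μ r : ℝ)
    (w : EuclideanSpace ℝ (Fin N) → ℝ) (x : EuclideanSpace ℝ (Fin N)) :
    0 ≤ potential Ω μ r w x :=
  integral_nonneg fun y => by positivity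

lemma potential_smul {t : ℝ} (ht : 0 < t) (Ω : Set (EuclideanSpace ℝ (Fin N))) (μ r : ℝ)
    (w : EuclideanSpace ℝ (Fin N) → ℝ) (x : EuclideanSpace ℝ (Fin N)) :
    potential Ω μ r (t • w) x = t ^ r * potential Ω μ r w x := by
  rw [potential, potential, ← integral_const_mul]
  refine integral_congr_ae (.of_forall fun y => ?_)
  simp only [Pi.smul_apply, smul_eq_mul, abs_mul, abs_of_pos ht]
  rw [Real.mul_rpow ht.le (abs_nonneg _), mul_div_assoc]

/-- The potential is the partial integral in y of the Choquard integrand with first function 1,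
hence measurable by Fubini. -/
lemma aestronglyMeasurable_potential (hv : AEStronglyMeasurable v volume) (μ r : ℝ) :
    AEStronglyMeasurable (potential Ω μ r v) (volume.restrict Ω) := by
  have h := (aemeasurable_choquardIntegrand (μ := μ) (p := 1) (q := r) (u := fun _ => (1 : ℝ))
    (ν₁ := volume.restrict Ω) (ν₂ := volume.restrict Ω) aemeasurable_const
    hv.aemeasurable.restrict).aestronglyMeasurable.integral_prod_right'
  refine h.congr (.of_forall fun x => ?_)
  simp [choquardIntegrand, potential]

namespace Subcritical

lemma choquardEnergy_eq (h : Subcritical s Ω μ p q) (hu : MemX s Ω u) (hv : MemX s Ω v) :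
    choquardEnergy Ω μ p q u v = ∫ x in Ω, |u x| ^ p * potential Ω μ q v x := by
  rw [choquardEnergy, integral_prod _ (h.integrable hu hv)]
  simp only [choquardIntegrand, integral_const_mul, potential]

lemma integrable_rpow_mul_potential (h : Subcritical s Ω μ p q) (hu : MemX s Ω u)
    (hv : MemX s Ω v) :
    Integrable (fun x => |u x| ^ p * potential Ω μ q v x) (volume.restrict Ω) := by
  have := (h.integrable hu hv).integral_prod_left
  simpa only [choquardIntegrand, integral_const_mul, potential] using this

/-- Differentiation under the integral sign, with p > 1 making |·|^p differentiable at 0 as well.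
For |t| < 1 the derivative is dominated by p(|u|+|φ|)^p times the potential, integrable because
|u|+|φ| lies in X(Ω). -/
lemma hasDerivAt_choquardEnergy (h : Subcritical s Ω μ p q) (hu : MemX s Ω u) (hv : MemX s Ω v)
    (hφ : MemX s Ω φ) :
    HasDerivAt (fun t : ℝ => choquardEnergy Ω μ p q (u + t • φ) v)
      (p * ∫ x in Ω, potential Ω μ q v x * (|u x| ^ (p - 2) * u x) * φ x) 0 := by
  have hp0 : 0 < p := one_pos.trans h.one_lt_p
  have hV := aestronglyMeasurable_potential (Ω := Ω) hv.memLp.1 μ q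
  have hS := hu.abs.add hφ.abs
  have hum := hu.memLp.1.aemeasurable.restrict (s := Ω)
  have hφm := hφ.memLp.1.aemeasurable.restrict (s := Ω)
  have hd := hasDerivAt_integral_of_dominated_loc_of_deriv_le (μ := volume.restrict Ω) (𝕜 := ℝ)
    (x₀ := (0 : ℝ)) (s := Metric.ball 0 1)
    (F := fun t x => |u x + t * φ x| ^ p * potential Ω μ q v x)
    (F' := fun t x => p * |u x + t * φ x| ^ (p - 2) * (u x + t * φ x) * φ x * potential Ω μ q v x)
    (bound := fun x => p * (|(|u x| + |φ x|)| ^ p * potential Ω μ q v x))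
    (Metric.ball_mem_nhds 0 one_pos)
    (.of_forall fun t => (((hum.add (hφm.const_mul t)).norm.pow_const p).mul
      hV.aemeasurable).aestronglyMeasurable)
    (by simpa using h.integrable_rpow_mul_potential hu hv)
    (by
      simp only [zero_mul, add_zero]
      exact (((((hum.norm.pow_const (p - 2)).const_mul p).mul hum).mul hφm).mul
        hV.aemeasurable).aestronglyMeasurable)
    (.of_forall fun x t ht => by
      have ht1 : |t| < 1 := by simpa using ht
      have hVx := potential_nonneg Ω μ q v x
      have hle : |u x + t * φ x| ≤ |u x| + |φ x| := by
        refine (abs_add_le _ _).trans (add_le_add_right ?_ _)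
        rw [abs_mul]
        exact mul_le_of_le_one_left (abs_nonneg _) ht1.le
      have hS0 : 0 ≤ |u x| + |φ x| := by positivity
      rw [Real.norm_eq_abs, abs_mul, abs_mul, abs_mul, abs_mul, abs_of_nonneg hVx,
        abs_of_pos hp0, abs_of_nonneg (by positivity : 0 ≤ |u x + t * φ x| ^ (p - 2)),
        abs_of_nonneg hS0, mul_assoc p, mul_assoc p, mul_assoc p]
      refine mul_le_mul_of_nonneg_left (mul_le_mul_of_nonneg_right ?_ hVx) hp0.le
      rcases (abs_nonneg (u x + t * φ x)).eq_or_lt with h0 | h0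
      · rw [← h0, mul_zero, zero_mul]
        positivity
      · have hSpos := h0.trans_le hle
        have e1 : |u x + t * φ x| ^ (p - 2) * |u x + t * φ x| = |u x + t * φ x| ^ (p - 1) := by
          rw [← Real.rpow_add_one h0.ne']
          congr 1
          ring
        have e2 : (|u x| + |φ x|) ^ p = (|u x| + |φ x|) ^ (p - 1) * (|u x| + |φ x|) := by
          rw [← Real.rpow_add_one hSpos.ne']
          congr 1
          ring
        rw [e1, e2]
        have hp1 : 0 ≤ p - 1 := by linarith [h.one_lt_p]
        gcongr
        linarith [abs_nonneg (u x)])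
    ((h.integrable_rpow_mul_potential hS hv).const_mul p)
    (.of_forall fun x t _ => by
      have h1 : HasDerivAt (fun t : ℝ => u x + t * φ x) (φ x) t := by
        simpa using ((hasDerivAt_id t).mul_const (φ x)).const_add (u x)
      exact ((hasDerivAt_abs_rpow _ h.one_lt_p).comp t h1).mul_const _)
  have hd := hd.2
  have e1 : (fun t : ℝ => choquardEnergy Ω μ p q (u + t • φ) v) =
      fun t => ∫ x in Ω, |u x + t * φ x| ^ p * potential Ω μ q v x := by
    ext t
    rw [h.choquardEnergy_eq (hu.add (hφ.smul t)) hv]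
    simp only [Pi.add_apply, Pi.smul_apply, smul_eq_mul]
  rw [e1, ← integral_const_mul]
  refine hd.congr_deriv (integral_congr_ae (.of_forall fun x => ?_))
  simp only [zero_mul, add_zero]
  ring

lemma quadEnergy_add_smul (hu : MemX s Ω u) (hv : MemX s Ω v) (hφ : MemX s Ω φ) (t : ℝ) :
    quadEnergy s a b c (u + t • φ) v = quadEnergy s a b c u v +
      t * (2 * (innerX s u φ - (a * ∫ x, u x * φ x) - b * ∫ x, v x * φ x)) +
      t ^ 2 * (innerX s φ φ - a * ∫ x, φ x ^ 2) := by
  have h1 : ∫ x, (u + t • φ) x ^ 2 =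
      (∫ x, u x ^ 2) + (2 * t * ∫ x, u x * φ x) + t ^ 2 * ∫ x, φ x ^ 2 := by
    have i1 := hu.memLp.integrable_sq
    have i2 := (hu.integrable_mul hφ).const_mul (2 * t)
    have i3 := hφ.memLp.integrable_sq.const_mul (t ^ 2)
    have i12 : Integrable (fun x => u x ^ 2 + 2 * t * (u x * φ x)) volume := i1.add i2
    rw [← integral_const_mul, ← integral_const_mul, ← integral_add i1 i2, ← integral_add i12 i3]
    refine integral_congr_ae (.of_forall fun x => ?_)
    simp only [Pi.add_apply, Pi.smul_apply, smul_eq_mul]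
    ring
  have h2 : ∫ x, (u + t • φ) x * v x = (∫ x, u x * v x) + t * ∫ x, v x * φ x := by
    rw [← integral_const_mul, ← integral_add (hu.integrable_mul hv)
      ((hv.integrable_mul hφ).const_mul t)]
    refine integral_congr_ae (.of_forall fun x => ?_)
    simp only [Pi.add_apply, Pi.smul_apply, smul_eq_mul]
    ring
  rw [quadEnergy, quadEnergy, h1, h2, innerX_add_smul_self hu hφ]
  ring

/-- The Euler–Lagrange equation of the maximizer in its first component. -/
theorem euler_lagrange (h : Subcritical s Ω μ p q) (hu : MemX s Ω u) (hv : MemX s Ω v) {M : ℝ}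
    (hQ : quadEnergy s a b c u v = 1) (hM : choquardEnergy Ω μ p q u v = M)
    (hmax : ∀ u' v' : EuclideanSpace ℝ (Fin N) → ℝ, MemX s Ω u' → MemX s Ω v' →
      choquardEnergy Ω μ p q u' v' ≤ M * quadEnergy s a b c u' v' ^ ((p + q) / 2))
    (hφ : MemX s Ω φ) :
    M * (p + q) * (innerX s u φ - (a * ∫ x, u x * φ x) - b * ∫ x, v x * φ x) =
      p * ∫ x in Ω, potential Ω μ q v x * (|u x| ^ (p - 2) * u x) * φ x := by
  set L := innerX s u φ - (a * ∫ x, u x * φ x) - b * ∫ x, v x * φ x with hL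
  set L₂ := innerX s φ φ - a * ∫ x, φ x ^ 2
  have hQt : ∀ t : ℝ, quadEnergy s a b c (u + t • φ) v = 1 + t * (2 * L) + t ^ 2 * L₂ := fun t => by
    rw [quadEnergy_add_smul hu hv hφ, hQ]
  have hd1 : HasDerivAt (fun t : ℝ => 1 + t * (2 * L) + t ^ 2 * L₂) (2 * L) 0 := by
    have := (((hasDerivAt_id (0 : ℝ)).mul_const (2 * L)).const_add 1).add
      ((hasDerivAt_pow 2 (0 : ℝ)).mul_const L₂)
    exact this.congr_deriv (by simp)
  have hd2 : HasDerivAt (fun t : ℝ => M * quadEnergy s a b c (u + t • φ) v ^ ((p + q) / 2))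
      (M * (2 * L * ((p + q) / 2))) 0 := by
    simp only [hQt]
    have := (hd1.rpow_const (p := (p + q) / 2) (.inl (by simp))).const_mul M
    simpa using this
  have hd3 := hd2.sub (h.hasDerivAt_choquardEnergy hu hv hφ)
  -- The homogeneous inequality holds for all pairs without constraint and is an equality at t = 0,
  -- so no Lagrange multiplier is needed.
  have hmin : IsLocalMin ((fun t : ℝ => M * quadEnergy s a b c (u + t • φ) v ^ ((p + q) / 2)) -
      fun t : ℝ => choquardEnergy Ω μ p q (u + t • φ) v) 0 := by
    refine .of_forall fun t => ?_
    simp only [Pi.sub_apply, zero_smul, add_zero, hQ, hM, Real.one_rpow, mul_one, sub_self]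
    exact sub_nonneg.2 (hmax _ _ (hu.add (hφ.smul t)) hv)
  have := hmin.hasDerivAt_eq_zero hd3
  linarith

/-- The first component of a nonnegative maximizer is positive. -/
lemma ae_pos_of_maximizer (h : Subcritical s Ω μ p q) (hs1 : s < 1) (hb : 0 ≤ b) (hu : MemX s Ω u)
    (hv : MemX s Ω v) (hu0 : ∀ x, 0 ≤ u x) (hv0 : ∀ x, 0 ≤ v x) {M : ℝ} (hM0 : 0 < M)
    (hM : choquardEnergy Ω μ p q u v = M)
    (heq : ∀ φ, MemX s Ω φ →
      M * (p + q) * (innerX s u φ - (a * ∫ x, u x * φ x) - b * ∫ x, v x * φ x) =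
      p * ∫ x in Ω, potential Ω μ q v x * (|u x| ^ (p - 2) * u x) * φ x) :
    ∀ᵐ x ∂(volume.restrict Ω), 0 < u x := by
  have hp0 := one_pos.trans h.one_lt_p
  have hq0 := one_pos.trans h.one_lt_q
  have hN1 : 1 ≤ N := by
    have : (0 : ℝ) < N := h.mu_pos.trans h.mu_lt
    exact_mod_cast this
  -- The first component is nontrivial since M > 0. The coupling and nonlinear terms are
  -- nonnegative, so only a·u can be negative, which gives the constant |a|.
  refine ae_pos_of_supersolution h.s_pos hs1 hN1 h.isOpen h.isBounded hu hu0 (fun h0 => ?_)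
    (abs_nonneg a) fun φ hφ hφ0 => ?_
  · rw [h.choquardEnergy_eq hu hv, integral_congr_ae (g := fun _ => (0 : ℝ))] at hM
    · rw [integral_zero] at hM
      exact hM0.ne hM
    · filter_upwards [ae_restrict_of_ae h0] with x hx
      rw [hx, Pi.zero_apply, abs_zero, Real.zero_rpow hp0.ne', zero_mul]
  · have h1 : 0 ≤ ∫ x in Ω, potential Ω μ q v x * (|u x| ^ (p - 2) * u x) * φ x := by
      refine integral_nonneg fun x => ?_
      have := potential_nonneg Ω μ q v x
      have := hu0 x
      have := hφ0 x
      dsimp only [Pi.zero_apply]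
      positivity
    have h2 : 0 ≤ innerX s u φ - (a * ∫ x, u x * φ x) - b * ∫ x, v x * φ x := by
      refine nonneg_of_mul_nonneg_right (a := M * (p + q)) ?_ (by positivity)
      rw [heq φ hφ]
      exact mul_nonneg hp0.le h1
    have h3 : 0 ≤ ∫ x, u x * φ x := integral_nonneg fun x => mul_nonneg (hu0 x) (hφ0 x)
    have h4 : 0 ≤ ∫ x, v x * φ x := integral_nonneg fun x => mul_nonneg (hv0 x) (hφ0 x)
    have h5 : 0 ≤ b * ∫ x, v x * φ x := mul_nonneg hb h4
    have h6 := mul_le_mul_of_nonneg_right (neg_abs_le a) h3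
    linarith

end Subcritical

lemma quadEnergy_comm (a b c : ℝ) (u v : EuclideanSpace ℝ (Fin N) → ℝ) :
    quadEnergy s a b c u v = quadEnergy s c b a v u := by
  simp only [quadEnergy, mul_comm (u _)]
  ring

lemma nonlinearity_smul {t : ℝ} (ht : 0 < t) (u v : EuclideanSpace ℝ (Fin N) → ℝ)
    (x : EuclideanSpace ℝ (Fin N)) :
    nonlinearity s Ω μ p q 0 (t • u) (t • v) x =
      2 * p / (p + q) * t ^ (p + q - 1) * (potential Ω μ q v x * (|u x| ^ (p - 2) * u x)) := by
  rw [nonlinearity, potential_smul ht]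
  simp only [Pi.smul_apply, smul_eq_mul, abs_mul, abs_of_pos ht, mul_zero, zero_mul, add_zero]
  rw [Real.mul_rpow ht.le (abs_nonneg _), show p + q - 1 = q + (p - 2) + 1 by ring,
    Real.rpow_add_one ht.ne', Real.rpow_add ht]
  ring

/-- Rescaling turns the Euler–Lagrange equation into an equation of the system. -/
lemma equation_of_euler_lagrange {M t : ℝ} (hM : 0 < M) (hp : 0 < p) (hq : 0 < q) (ht : 0 < t)
    (htM : t ^ (p + q - 2) = (2 * M)⁻¹)
    (heq : M * (p + q) * (innerX s u φ - (a * ∫ x, u x * φ x) - b * ∫ x, v x * φ x) =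
      p * ∫ x in Ω, potential Ω μ q v x * (|u x| ^ (p - 2) * u x) * φ x) :
    ∫ x in Ω, nonlinearity s Ω μ p q 0 (t • u) (t • v) x * φ x =
      t * (innerX s u φ - (a * ∫ x, u x * φ x) - b * ∫ x, v x * φ x) := by
  simp only [nonlinearity_smul ht, mul_assoc (2 * p / (p + q) * t ^ (p + q - 1))]
  rw [integral_const_mul, show p + q - 1 = p + q - 2 + 1 by ring, Real.rpow_add_one ht.ne', htM]
  have h1 : ∫ x in Ω, potential Ω μ q v x * (|u x| ^ (p - 2) * u x) * φ x =
      M * (p + q) * (innerX s u φ - (a * ∫ x, u x * φ x) - b * ∫ x, v x * φ x) / p := by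
    rw [heq]
    field_simp
  rw [h1]
  field_simp

lemma integral_linear_part {ψ : EuclideanSpace ℝ (Fin N) → ℝ} (hu : MemX s Ω u) (hv : MemX s Ω v)
    (hφ : MemX s Ω φ) (hψ : MemX s Ω ψ) (t : ℝ) :
    ∫ x in Ω, ((a * (t • u) x + b * (t • v) x) * φ x + (b * (t • u) x + c * (t • v) x) * ψ x) =
      t * (((a * ∫ x, u x * φ x) + b * ∫ x, v x * φ x) +
        ((c * ∫ x, v x * ψ x) + b * ∫ x, u x * ψ x)) := by
  rw [setIntegral_eq_integral_of_ae_compl_eq_zero]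
  · have i1 := (hu.integrable_mul hφ).const_mul a
    have i2 := (hv.integrable_mul hφ).const_mul b
    have i3 := (hv.integrable_mul hψ).const_mul c
    have i4 := (hu.integrable_mul hψ).const_mul b
    have i12 : Integrable (fun x => a * (u x * φ x) + b * (v x * φ x)) volume := i1.add i2
    have i34 : Integrable (fun x => c * (v x * ψ x) + b * (u x * ψ x)) volume := i3.add i4
    rw [← integral_const_mul, ← integral_const_mul, ← integral_const_mul, ← integral_const_mul,
      ← integral_add i1 i2, ← integral_add i3 i4, ← integral_add i12 i34, ← integral_const_mul]
    refine integral_congr_ae (.of_forall fun x => ?_)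
    simp only [Pi.smul_apply, smul_eq_mul]
    ring
  · filter_upwards [hφ.ae_eq_zero, hψ.ae_eq_zero] with x h1 h2 hx
    simp [h1 hx, h2 hx]

end FracChoquard

end

/-! ### Conclusion: both equations and positivity. -/

theorem theorem1p2 (N : ℕ) (s : ℝ) (hs0 : 0 < s) (hs1 : s < 1) (hN : 2 * s < (N : ℝ))
    (Ω : Set (EuclideanSpace ℝ (Fin N))) (hΩo : IsOpen Ω) (hΩc : IsConnected Ω)
    (hΩb : Bornology.IsBounded Ω)
    (μ : ℝ) (hμ0 : 0 < μ) (hμN : μ < (N : ℝ))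
    (p q : ℝ) (hp1 : 1 < p) (hp : p < FracChoquard.critExp N s μ)
    (hq1 : 1 < q) (hq : q < FracChoquard.critExp N s μ)
    (a b c : ℝ) (hb : 0 ≤ b)
    (μ₂ : ℝ)
    (hμ₂ : IsGreatest
      {m : ℝ | Module.End.HasEigenvalue (Matrix.toLin' !![a, b; b, c]) m} μ₂)
    (hlam : μ₂ < FracChoquard.firstEigenvalue s Ω) :
    ∃ u v : EuclideanSpace ℝ (Fin N) → ℝ,
      FracChoquard.IsWeakSolution s Ω μ p q a b c 0 0 u v ∧
        ∀ᵐ x ∂(MeasureTheory.volume.restrict Ω), 0 < u x ∧ 0 < v x := by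
  have hsub : FracChoquard.Subcritical s Ω μ p q :=
    ⟨hs0, hN, hΩo, hΩb, hμ0, hμN, hp1, hp, hq1, hq⟩
  have hp0 := one_pos.trans hp1
  have hq0 := one_pos.trans hq1
  obtain ⟨δ, hδ, hco⟩ := FracChoquard.exists_pos_mul_le_quadEnergy hμ₂ hlam
  obtain ⟨u, v, M, hu, hv, hu0, hv0, hM0, hQ, hM, hmax⟩ :=
    hsub.exists_maximizer hs1 hΩc.nonempty hb hδ hco
  have hELu := fun φ (hφ : FracChoquard.MemX s Ω φ) => hsub.euler_lagrange hu hv hQ hM hmax hφ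
  have hM' : FracChoquard.choquardEnergy Ω μ q p v u = M := by
    rw [FracChoquard.choquardEnergy_comm, hM]
  -- The second equation is the first one after exchanging u with v, p with q, and a with c.
  have hELv := fun φ (hφ : FracChoquard.MemX s Ω φ) => hsub.symm.euler_lagrange hv hu
    (by rw [FracChoquard.quadEnergy_comm, hQ]) hM'
    (fun u' v' hu' hv' => by
      rw [FracChoquard.choquardEnergy_comm, FracChoquard.quadEnergy_comm, add_comm q p]
      exact hmax v' u' hv' hu') hφ
  have hposu := hsub.ae_pos_of_maximizer hs1 hb hu hv hu0 hv0 hM0 hM hELu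
  have hposv := hsub.symm.ae_pos_of_maximizer hs1 hb hv hu hv0 hu0 hM0 hM' hELv
  -- Scaling by t multiplies the linear side by t and the nonlinear one by t^(p+q-1). The
  -- Euler–Lagrange factor M(p+q)/p times 2p/(p+q) is 2M, the same for both equations, so one t with
  -- t^(p+q-2) = 1/(2M) serves both; it exists as p + q > 2.
  obtain ⟨t, ht, htM⟩ : ∃ t : ℝ, 0 < t ∧ t ^ (p + q - 2) = (2 * M)⁻¹ := by
    refine ⟨(2 * M)⁻¹ ^ (p + q - 2)⁻¹, by positivity, ?_⟩
    rw [← Real.rpow_mul (by positivity), inv_mul_cancel₀ (by linarith), Real.rpow_one]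
  refine ⟨t • u, t • v, ⟨hu.smul t, hv.smul t, fun φ ψ hφ hψ => ?_⟩, ?_⟩
  · rw [FracChoquard.equation_of_euler_lagrange hM0 hp0 hq0 ht htM (hELu φ hφ),
      FracChoquard.equation_of_euler_lagrange hM0 hq0 hp0 ht (by rwa [add_comm q p]) (hELv ψ hψ),
      FracChoquard.integral_linear_part hu hv hφ hψ, FracChoquard.innerX_smul_left,
      FracChoquard.innerX_smul_left]
    ring
  · filter_upwards [hposu, hposv] with x h1 h2
    exact ⟨mul_pos ht h1, mul_pos ht h2⟩
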